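/- Let $F$ be a symmetric, non-degenerate, half-integral $n\times n$ matrix (that is, $2F$ has integer entries and even diagonal entries, and $\det F\neq 0$), and let $D_F=\mathbb Z^n/2F\mathbb Z^n$, with the quadratic form $Q:D_F\to\mathbb Q/\mathbb Z$ induced by $x\mapsto \tfrac14 x^tF^{-1}x$ and with $B(x,y)=Q(x+y)-Q(x)-Q(y)$. Write $e(x)=\exp(2\pi i x)$. For a finite abelian group $M$ with a quadratic form $Q_M:M\to\mathbb Q/\mathbb Z$ put $\sigma(M)=|M|^{-1/2}\sum_{x\in M}e(-Q_M(x))$, and for a prime $p$ put $\sigma_p(M)=\sigma(M(p))$, where $M(p)$ is the $p$-part of $M$ with the restricted quadratic form. Let $\mathrm{Mp}_2(\mathbb Z)$ be the metaplectic group of all pairs $(A,w)$, where $A=\begin{pmatrix}a&b\\c&d\end{pmatrix}\in \mathrm{SL}_2(\mathbb Z)$ and $w$ is a holomorphic function on the upper half plane with $w(\tau)^2=c\tau+d$, with composition $(A,w)(B,v)=(AB,\,w(B\tau)v(\tau))$. Suppose that $\dim_{\mathbb F_p}D_F\otimes\mathbb F_p\le 2$ for all primes $p$. Then the formulas $$\left(\begin{pmatrix}1&1\\0&1\end{pmatrix},1\right)\mathbf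 e_x=e(Q(x))\,\mathbf e_x,\qquad \left(\begin{pmatrix}0&-1\\1&0\end{pmatrix},\sqrt{\tau}\right)\mathbf e_x=\sigma(D_F)\,|D_F|^{-1/2}\sum_{y\in D_F}e(-B(y,x))\,\mathbf e_y$$ (with the principal branch of $\sqrt\tau$) extend to an action of $\mathrm{Mp}_2(\mathbb Z)$ on $\mathbb C[D_F]=\bigoplus_{x\in D_F}\mathbb C\,\mathbf e_x$, the Weil representation $W(F)$. Moreover, for the subspace $\mathrm{Inv}(F)$ of $\mathrm{Mp}_2(\mathbb Z)$-invariant vectors in $W(F)$, one has $\mathrm{Inv}(F)\neq 0$ if and only if $|\det(2F)|$ is a perfect square and $\sigma_p(D_F)=1$ for all primes $p$. -/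

import Mathlib

open scoped UpperHalfPlane TensorProduct MatrixGroups Manifold

noncomputable section

/-! ### The metaplectic group -/

/-- The metaplectic double cover of `SL(2, ℤ)`: pairs `(A, w)` with `A ∈ SL(2, ℤ)` and `w` a
holomorphic function on the upper half plane with `w(τ)² = cτ + d`, where `(c, d)` is the lower
row of `A`. -/
@[ext]
structure Metaplectic where
  mat : SL(2, ℤ)
  root : ℍ → ℂ
  holo : MDifferentiable 𝓘(ℂ) 𝓘(ℂ) root
  root_sq : ∀ τ : ℍ, root τ ^ 2 = (mat 1 0 : ℂ) * (τ : ℂ) + (mat 1 1 : ℂ)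

namespace Metaplectic

theorem holo_smul (A : SL(2, ℤ)) : MDifferentiable 𝓘(ℂ) 𝓘(ℂ) (fun τ : ℍ => A • τ) :=
  UpperHalfPlane.mdifferentiable_smul (g := (A : GL (Fin 2) ℝ)) (by simp)

theorem auto_ne_zero (A : SL(2, ℤ)) (τ : ℍ) :
    (A 1 0 : ℂ) * (τ : ℂ) + (A 1 1 : ℂ) ≠ 0 := by
  have h := UpperHalfPlane.denom_ne_zero (A : GL (Fin 2) ℝ) τ
  simpa [UpperHalfPlane.denom] using h

theorem auto_mul (A B : SL(2, ℤ)) (τ : ℍ) :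
    ((A * B) 1 0 : ℂ) * (τ : ℂ) + ((A * B) 1 1 : ℂ) =
      ((A 1 0 : ℂ) * ((B • τ : ℍ) : ℂ) + (A 1 1 : ℂ)) *
        ((B 1 0 : ℂ) * (τ : ℂ) + (B 1 1 : ℂ)) := by
  have h := auto_ne_zero B τ
  rw [UpperHalfPlane.coe_specialLinearGroup_apply]
  simp only [Matrix.SpecialLinearGroup.coe_mul, Matrix.mul_apply, Fin.sum_univ_two,
    algebraMap_int_eq, eq_intCast, Int.cast_add, Int.cast_mul, Complex.ofReal_intCast]
  field_simp
  ring

theorem root_ne_zero (g : Metaplectic) (τ : ℍ) : g.root τ ≠ 0 := by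
  intro h
  apply auto_ne_zero g.mat τ
  rw [← g.root_sq, h]
  simp

theorem holo_inv {f : ℍ → ℂ} (hf : MDifferentiable 𝓘(ℂ) 𝓘(ℂ) f) (h0 : ∀ τ, f τ ≠ 0) :
    MDifferentiable 𝓘(ℂ) 𝓘(ℂ) (fun τ => (f τ)⁻¹) := by
  rw [UpperHalfPlane.mdifferentiable_iff] at hf ⊢
  exact hf.inv (fun z _ => h0 _)

/-- The composition law `(A, w) (B, v) = (AB, w(Bτ) v(τ))`. -/
instance : Mul Metaplectic where
  mul g h :=
    { mat := g.mat * h.mat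
      root := fun τ => g.root (h.mat • τ) * h.root τ
      holo := by
        have h1 : MDifferentiable 𝓘(ℂ) 𝓘(ℂ) (fun τ : ℍ => g.root (h.mat • τ)) :=
          g.holo.comp (holo_smul h.mat)
        exact h1.mul h.holo
      root_sq := fun τ => by rw [mul_pow, g.root_sq, h.root_sq, auto_mul] }

instance : One Metaplectic where
  one :=
    { mat := 1
      root := fun _ => 1
      holo := mdifferentiable_const
      root_sq := fun τ => by simp }

instance : Inv Metaplectic where
  inv g :=
    { mat := g.mat⁻¹
      root := fun τ => (g.root (g.mat⁻¹ • τ))⁻¹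
      holo := holo_inv (g.holo.comp (holo_smul g.mat⁻¹)) (fun τ => g.root_ne_zero _)
      root_sq := fun τ => by
        have h := auto_mul g.mat g.mat⁻¹ τ
        rw [mul_inv_cancel] at h
        rw [inv_pow, g.root_sq]
        refine inv_eq_of_mul_eq_one_right ?_
        rw [← h]
        simp }

@[simp] theorem mul_mat (g h : Metaplectic) : (g * h).mat = g.mat * h.mat := rfl

@[simp] theorem mul_root (g h : Metaplectic) (τ : ℍ) :
    (g * h).root τ = g.root (h.mat • τ) * h.root τ := rfl

@[simp] theorem one_mat : (1 : Metaplectic).mat = 1 := rfl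

@[simp] theorem one_root (τ : ℍ) : (1 : Metaplectic).root τ = 1 := rfl

@[simp] theorem inv_mat (g : Metaplectic) : (g⁻¹).mat = g.mat⁻¹ := rfl

@[simp] theorem inv_root (g : Metaplectic) (τ : ℍ) :
    (g⁻¹).root τ = (g.root (g.mat⁻¹ • τ))⁻¹ := rfl

instance : Group Metaplectic :=
  Group.ofLeftAxioms
    (fun a b c => Metaplectic.ext (mul_assoc _ _ _) (by
      funext τ
      simp [mul_smul, mul_assoc]))
    (fun a => Metaplectic.ext (one_mul _) (by funext τ; simp))
    (fun a => Metaplectic.ext (inv_mul_cancel _) (by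
      funext τ
      simp [a.root_ne_zero]))

/-- The element `(T, 1)`, where `T = [1, 1; 0, 1]`. -/
def T : Metaplectic where
  mat := ModularGroup.T
  root := fun _ => 1
  holo := mdifferentiable_const
  root_sq := fun τ => by simp [ModularGroup.T]

/-- The element `(S, √τ)`, where `S = [0, -1; 1, 0]` and the square root is the principal one. -/
def S : Metaplectic where
  mat := ModularGroup.S
  root := fun τ => (τ : ℂ) ^ (1 / 2 : ℂ)
  holo := by
    rw [UpperHalfPlane.mdifferentiable_iff]
    have h : DifferentiableOn ℂ (fun z : ℂ => z ^ (1 / 2 : ℂ)) {z | 0 < z.im} := fun z hz =>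
      ((differentiableAt_id).cpow_const
        (Or.inr (ne_of_gt hz) : z ∈ Complex.slitPlane)).differentiableWithinAt
    refine h.congr (fun z hz => ?_)
    simp [UpperHalfPlane.ofComplex_apply_of_im_pos hz]
  root_sq := fun τ => by
    rw [← Complex.cpow_nat_mul]
    simp [ModularGroup.S]

end Metaplectic

/-! ### Finite quadratic modules

A finite quadratic module is a finite abelian group `M` with a quadratic form
`Q : QuadraticMap ℤ M (AddCircle (1 : ℚ))`; the target is `ℚ/ℤ`. -/

/-- The character `e(x) = exp(2πix)` of `ℚ/ℤ`. -/
def eChar : AddCircle (1 : ℚ) → ℂ :=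
  Function.Periodic.lift (f := fun q : ℚ => Complex.exp (2 * Real.pi * Complex.I * (q : ℂ)))
    (fun q => by
      have h : (2 * Real.pi * Complex.I * ((q + 1 : ℚ) : ℂ)) =
          2 * Real.pi * Complex.I * (q : ℂ) + 2 * Real.pi * Complex.I := by
        push_cast
        ring
      simp only [h, Complex.exp_periodic _])

section QuadraticModule

variable {M : Type*} [AddCommGroup M] [Finite M]

/-- `σ(M) = |M|^(-1/2) ∑_{x ∈ M} e(-Q(x))`. -/
def gaussSigma (Q : QuadraticMap ℤ M (AddCircle (1 : ℚ))) : ℂ :=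
  ((Real.sqrt (Nat.card M) : ℝ) : ℂ)⁻¹ * ∑ᶠ x : M, eChar (-Q x)

/-- The restriction of the quadratic form to the `p`-part `M(p)` of `M`. -/
def primaryForm (Q : QuadraticMap ℤ M (AddCircle (1 : ℚ))) (p : ℕ) :
    QuadraticMap ℤ (AddCommGroup.primaryComponent M p) (AddCircle (1 : ℚ)) :=
  Q.comp (AddCommGroup.primaryComponent M p).subtype.toIntLinearMap

/-- `σ_p(M) = σ(M(p))`. -/
def sigmaPrime (Q : QuadraticMap ℤ M (AddCircle (1 : ℚ))) (p : ℕ) : ℂ :=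
  gaussSigma (primaryForm Q p)

/-- `ρ` is the Weil representation `W(M)`: it is a representation of the metaplectic group on the
space `ℂ[M]` of formal linear combinations of the elements of `M`, and on basis elements
`(T, 1)` and `(S, √τ)` act by
`T x = e(Q(x)) x` and `S x = σ(M) |M|^(-1/2) ∑_y e(-B(y, x)) y`. -/
structure IsWeilRepresentation (Q : QuadraticMap ℤ M (AddCircle (1 : ℚ)))
    (ρ : Representation ℂ Metaplectic (M →₀ ℂ)) : Prop where
  T_apply : ∀ x : M,
    ρ Metaplectic.T (Finsupp.single x 1) = eChar (Q x) • Finsupp.single x 1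
  S_apply : ∀ x : M,
    ρ Metaplectic.S (Finsupp.single x 1) =
      (gaussSigma Q * ((Real.sqrt (Nat.card M) : ℝ) : ℂ)⁻¹) •
        ∑ᶠ y : M, eChar (-QuadraticMap.polar Q y x) • Finsupp.single y (1 : ℂ)

end QuadraticModule

/-! ### Half-integral matrices and their determinant groups -/

/-- A symmetric non-degenerate half-integral matrix `F`: `2F` has integral entries and even
diagonal entries. -/
structure HalfIntegralMatrix (n : ℕ) where
  mat : Matrix (Fin n) (Fin n) ℚ
  symm : mat.IsSymm
  integral : ∀ i j, ∃ a : ℤ, 2 * mat i j = a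
  even_diag : ∀ i, ∃ a : ℤ, 2 * mat i i = 2 * a
  nondegenerate : mat.det ≠ 0

namespace HalfIntegralMatrix

open Matrix

variable {n : ℕ} (F : HalfIntegralMatrix n)

/-- An integral vector as a rational one. -/
def toRat : (Fin n → ℤ) →+ (Fin n → ℚ) where
  toFun x i := (x i : ℚ)
  map_zero' := by funext i; simp
  map_add' x y := by funext i; simp

@[simp] theorem toRat_apply (x : Fin n → ℤ) (i : Fin n) : toRat x i = (x i : ℚ) := rfl

/-- The subgroup `2Fℤⁿ` of `ℤⁿ`. -/
def lattice : AddSubgroup (Fin n → ℤ) where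
  carrier := {x | ∃ y : Fin n → ℤ, toRat x = ((2 : ℚ) • F.mat) *ᵥ toRat y}
  zero_mem' := ⟨0, by simp⟩
  add_mem' := by
    rintro x x' ⟨y, hy⟩ ⟨y', hy'⟩
    exact ⟨y + y', by rw [map_add, map_add, mulVec_add, hy, hy']⟩
  neg_mem' := by
    rintro x ⟨y, hy⟩
    exact ⟨-y, by rw [map_neg, map_neg, mulVec_neg, hy]⟩

/-- The determinant group `D_F = ℤⁿ/2Fℤⁿ`. -/
abbrev discGroup : Type := (Fin n → ℤ) ⧸ F.lattice

/-- `¼ F⁻¹[x] = ¼ xᵗ F⁻¹ x`. -/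
def quarterForm (x : Fin n → ℤ) : ℚ := (1 / 4) * (toRat x ⬝ᵥ (F.mat⁻¹ *ᵥ toRat x))

/-- `½ xᵗ F⁻¹ y`, the bilinear form of `quarterForm`. -/
def halfBilin (x y : Fin n → ℤ) : ℚ := (1 / 2) * (toRat x ⬝ᵥ (F.mat⁻¹ *ᵥ toRat y))

theorem dot_comm {A : Matrix (Fin n) (Fin n) ℚ} (hA : A.IsSymm) (u v : Fin n → ℚ) :
    u ⬝ᵥ (A *ᵥ v) = v ⬝ᵥ (A *ᵥ u) := by
  rw [dotProduct_mulVec, ← mulVec_transpose, hA.eq, dotProduct_comm]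

theorem inv_symm : (F.mat⁻¹).IsSymm := by
  rw [Matrix.IsSymm, transpose_nonsing_inv, F.symm.eq]

theorem halfBilin_add_left (x x' y : Fin n → ℤ) :
    F.halfBilin (x + x') y = F.halfBilin x y + F.halfBilin x' y := by
  simp only [halfBilin, map_add, add_dotProduct]
  ring

theorem quarterForm_add (x y : Fin n → ℤ) :
    F.quarterForm (x + y) = F.quarterForm x + F.quarterForm y + F.halfBilin x y := by
  simp only [quarterForm, halfBilin, map_add, add_dotProduct, mulVec_add, dotProduct_add]
  rw [dot_comm F.inv_symm (toRat y) (toRat x)]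
  ring

theorem quarterForm_zsmul (a : ℤ) (x : Fin n → ℤ) :
    F.quarterForm (a • x) = (a * a) • F.quarterForm x := by
  have h : toRat (a • x) = (a : ℚ) • toRat x := by
    funext i
    simp
  rw [quarterForm, quarterForm, h]
  simp only [mulVec_smul, smul_dotProduct, dotProduct_smul, smul_eq_mul, zsmul_eq_mul]
  push_cast
  ring

theorem halfBilin_int {x z : Fin n → ℤ} (hz : z ∈ F.lattice) :
    ∃ a : ℤ, F.halfBilin x z = a := by
  obtain ⟨y, hy⟩ := hz
  refine ⟨x ⬝ᵥ y, ?_⟩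
  have hdet : IsUnit F.mat.det := isUnit_iff_ne_zero.mpr F.nondegenerate
  rw [halfBilin, hy, mulVec_mulVec, Matrix.mul_smul, nonsing_inv_mul _ hdet, smul_mulVec,
    one_mulVec, dotProduct_smul]
  simp [dotProduct]

theorem two_mul_int (y y' : Fin n → ℤ) :
    ∃ a : ℤ, 2 * (toRat y ⬝ᵥ (F.mat *ᵥ toRat y')) = a := by
  choose G hG using F.integral
  refine ⟨∑ i, y i * ∑ j, G i j * y' j, ?_⟩
  simp only [dotProduct, mulVec, toRat_apply, Int.cast_sum, Int.cast_mul, Finset.mul_sum, ← hG]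
  refine Finset.sum_congr rfl fun i _ => Finset.sum_congr rfl fun j _ => ?_
  ring

theorem form_int (y : Fin n → ℤ) : ∃ a : ℤ, toRat y ⬝ᵥ (F.mat *ᵥ toRat y) = a := by
  rw [← Finset.univ_sum_single y]
  refine Finset.sum_induction _
    (fun y : Fin n → ℤ => ∃ a : ℤ, toRat y ⬝ᵥ (F.mat *ᵥ toRat y) = a) ?_ ⟨0, by simp⟩ ?_
  · rintro u v ⟨a, ha⟩ ⟨b, hb⟩
    obtain ⟨c, hc⟩ := F.two_mul_int u v
    refine ⟨a + b + c, ?_⟩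
    simp only [map_add, add_dotProduct, mulVec_add, dotProduct_add]
    rw [dot_comm F.symm (toRat v) (toRat u)]
    push_cast
    rw [← ha, ← hb, ← hc]
    ring
  · intro i _
    obtain ⟨b, hb⟩ := F.even_diag i
    refine ⟨y i * y i * b, ?_⟩
    have h : toRat (Pi.single i (y i)) = Pi.single i (y i : ℚ) := by
      funext j
      by_cases hj : j = i
      · subst hj; simp
      · simp [hj]
    have hb' : F.mat i i = b := by linarith
    rw [h, single_dotProduct, mulVec_single]
    simp [hb']
    ring

theorem quarterForm_int {z : Fin n → ℤ} (hz : z ∈ F.lattice) :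
    ∃ a : ℤ, F.quarterForm z = a := by
  obtain ⟨y, hy⟩ := hz
  obtain ⟨a, ha⟩ := F.form_int y
  refine ⟨a, ?_⟩
  have hdet : IsUnit F.mat.det := isUnit_iff_ne_zero.mpr F.nondegenerate
  rw [← ha, quarterForm, hy, mulVec_mulVec, Matrix.mul_smul, nonsing_inv_mul _ hdet,
    smul_mulVec, smul_mulVec, one_mulVec, dotProduct_smul, smul_dotProduct,
    dotProduct_comm]
  simp only [smul_eq_mul]
  ring

/-- `x ↦ ¼ F⁻¹[x]` as a map `D_F → ℚ/ℤ`. -/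
def discFun : F.discGroup → AddCircle (1 : ℚ) :=
  Quotient.lift (fun x : Fin n → ℤ => ((F.quarterForm x : ℚ) : AddCircle (1 : ℚ)))
    (fun x y hxy => by
      have hz : -x + y ∈ F.lattice := QuotientAddGroup.leftRel_apply.mp hxy
      obtain ⟨a, ha⟩ := F.quarterForm_int hz
      obtain ⟨b, hb⟩ := F.halfBilin_int (x := x) hz
      have h := F.quarterForm_add x (-x + y)
      rw [add_neg_cancel_left, ha, hb] at h
      have h' : F.quarterForm y = F.quarterForm x + ((a + b : ℤ) : ℚ) := by
        rw [h]
        push_cast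
        ring
      change ((F.quarterForm x : ℚ) : AddCircle (1 : ℚ)) = (F.quarterForm y : ℚ)
      rw [h', AddCircle.coe_add, left_eq_add, AddCircle.coe_eq_zero_iff]
      exact ⟨a + b, by simp⟩)

theorem discFun_mk (x : Fin n → ℤ) :
    F.discFun (x : F.discGroup) = ((F.quarterForm x : ℚ) : AddCircle (1 : ℚ)) := rfl

theorem polar_discFun_mk (x y : Fin n → ℤ) :
    QuadraticMap.polar F.discFun (x : F.discGroup) (y : F.discGroup) =
      ((F.halfBilin x y : ℚ) : AddCircle (1 : ℚ)) := by
  rw [QuadraticMap.polar, ← QuotientAddGroup.mk_add, discFun_mk, discFun_mk, discFun_mk,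
    quarterForm_add, AddCircle.coe_add, AddCircle.coe_add]
  abel

/-- The quadratic form on `D_F` induced by `x ↦ ¼ F⁻¹[x]`. -/
def discForm : QuadraticMap ℤ F.discGroup (AddCircle (1 : ℚ)) :=
  QuadraticMap.ofPolar F.discFun
    (fun a x => by
      induction x using QuotientAddGroup.induction_on with
      | H x =>
        rw [← QuotientAddGroup.mk_zsmul, discFun_mk, discFun_mk, quarterForm_zsmul,
          AddCircle.coe_zsmul])
    (fun x x' y => by
      induction x using QuotientAddGroup.induction_on with
      | H x =>
        induction x' using QuotientAddGroup.induction_on with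
        | H x' =>
          induction y using QuotientAddGroup.induction_on with
          | H y =>
            rw [← QuotientAddGroup.mk_add, polar_discFun_mk, polar_discFun_mk,
              polar_discFun_mk, halfBilin_add_left, AddCircle.coe_add])
    (fun a x y => by
      induction x using QuotientAddGroup.induction_on with
      | H x =>
        induction y using QuotientAddGroup.induction_on with
        | H y =>
          have h : F.halfBilin (a • x) y = a • F.halfBilin x y := by
            have h1 : toRat (a • x) = (a : ℚ) • toRat x := by
              funext i
              simp
            rw [halfBilin, halfBilin, h1]
            simp only [smul_dotProduct, smul_eq_mul, zsmul_eq_mul]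
            ring
          rw [← QuotientAddGroup.mk_zsmul, polar_discFun_mk, polar_discFun_mk, h,
            AddCircle.coe_zsmul])

instance : Finite F.discGroup := by
  have hG : ∃ G : Matrix (Fin n) (Fin n) ℤ, ∀ i j, 2 * F.mat i j = G i j :=
    ⟨fun i j => (F.integral i j).choose, fun i j => (F.integral i j).choose_spec⟩
  obtain ⟨G, hG⟩ := hG
  have hG' : G.map (Int.castRingHom ℚ) = (2 : ℚ) • F.mat := by
    ext i j
    simp [hG]
  have hdet : G.det ≠ 0 := by
    intro h0
    have h1 := RingHom.map_det (Int.castRingHom ℚ) G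
    rw [h0, RingHom.mapMatrix_apply, hG', det_smul, map_zero] at h1
    exact (mul_ne_zero (pow_ne_zero _ two_ne_zero) F.nondegenerate) h1.symm
  have hmem : ∀ x : Fin n → ℤ, G.det • x ∈ F.lattice := by
    intro x
    refine ⟨G.adjugate *ᵥ x, ?_⟩
    have h1 : G *ᵥ (G.adjugate *ᵥ x) = G.det • x := by
      rw [mulVec_mulVec, mul_adjugate, smul_mulVec, one_mulVec]
    rw [← h1, ← hG']
    generalize G.adjugate *ᵥ x = v
    funext i
    simp [mulVec, dotProduct]
  have : Module.Finite ℤ F.discGroup :=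
    Module.Finite.of_surjective (QuotientAddGroup.mk' F.lattice).toIntLinearMap
      (QuotientAddGroup.mk'_surjective F.lattice)
  refine Module.finite_of_fg_torsion F.discGroup (fun {x} => ?_)
  induction x using QuotientAddGroup.induction_on with
  | H x =>
    refine ⟨⟨G.det, mem_nonZeroDivisors_of_ne_zero hdet⟩, ?_⟩
    change G.det • (x : F.discGroup) = 0
    rw [← QuotientAddGroup.mk_zsmul, QuotientAddGroup.eq_zero_iff]
    exact hmem x

end HalfIntegralMatrix

end

/-!
The proof has three independent parts.

*The group.* `Mp₂(ℤ)` is presented by `S, T` with the relations `S² = (ST)³` and `S⁸ = 1`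
(`Metaplectic.exists_hom`). Since `S²` is central, a word in the generators is a power of `S²` times
a product of the positive matrices `[1, 1; 0, 1]` and `[1, 0; 1, 1]`, up to short factors at both
ends (`Metaplectic.exists_normal_form`). A nonempty positive product is never trivial, so the only
words to examine are powers of `S²`.

*The representation.* The matrices prescribed for `S` and `T` satisfy the two relations: the first
by completing the square (`weilS_mul_weilT_mul_weilS`), the second because `σ(M)⁸ = 1`
(`gaussSigma_pow_eight`). The last fact follows from the four squares theorem: an integral
quaternion of norm congruent to `-1` modulo `2|M|` turns `Q` into `-Q` on `M⁴`, so `σ(M)⁴` is real.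

*The invariants.* Since `S` and `T` generate, a vector `f` is invariant if and only if it is
supported on isotropic elements and is its own Fourier transform (`mem_invariants_iff`). Both
directions go through subgroups `U` with `U^⊥ = U` on which `Q` vanishes. For such `U` one has
`|M| = |U|²` and `σ(M) = 1`, and the characteristic function of `U` is invariant
(`invariants_ne_bot_of_selfDual`).

Given an invariant `f ≠ 0`, let `R` be the subgroup generated by its support. Being supported on
`R`, the function `f` is invariant under `R^⊥`, so `R^⊥` is isotropic. The `p`-part of `R` has rank
at most two and is generated by isotropic elements, hence by two of them, `x` and `y`, and then
`⟨x⟩ + R^⊥` is self-dual in the `p`-part (`exists_selfDual_of_generated`).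

Conversely let `U` be a maximal isotropic subgroup of a `p`-module of rank at most two, of square
order, with `σ = 1`, and suppose `U^⊥ ≠ U`. Then `U^⊥ / U` is anisotropic of order `p²`. For odd `p`
it is an anisotropic plane, whose Gauss sum is `-p` (`relIndex_eq_one_of_odd`); for `p = 2`, three
complex numbers of absolute value one and sum one include the number one, which gives a nonzero
isotropic element (`relIndex_eq_one_of_two`). Both contradict the assumptions, so `U^⊥ = U`.
-/

noncomputable section

/-! ### Generators and relations for the metaplectic group -/

namespace Metaplectic

/-- The projection `(A, w) ↦ A`. -/
def matHom : Metaplectic →* SL(2, ℤ) where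
  toFun := mat
  map_one' := rfl
  map_mul' _ _ := rfl

@[simp] theorem matHom_apply (g : Metaplectic) : matHom g = g.mat := rfl

/-- Two holomorphic square roots of the same automorphy factor agree up to a global sign, since
the upper half plane is connected. -/
theorem root_eq_or_eq_neg {g h : Metaplectic} (hm : g.mat = h.mat) :
    (∀ τ, g.root τ = h.root τ) ∨ ∀ τ, g.root τ = -h.root τ := by
  have hS : IsPreconnected (Set.univ : Set ℍ) := isPreconnected_univ
  rcases hS.eq_or_eq_neg_of_sq_eq g.holo.continuous.continuousOn h.holo.continuous.continuousOn
    (fun τ _ => by simp only [Pi.pow_apply]; rw [g.root_sq, h.root_sq, hm])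
    (fun {τ} _ => h.root_ne_zero τ) with h1 | h1
  · exact Or.inl fun τ => h1 (Set.mem_univ τ)
  · exact Or.inr fun τ => h1 (Set.mem_univ τ)

theorem ext_of_root_eq {g h : Metaplectic} (hm : g.mat = h.mat) (τ : ℍ)
    (hr : g.root τ = h.root τ) : g = h := by
  rcases root_eq_or_eq_neg hm with h1 | h1
  · exact Metaplectic.ext hm (funext h1)
  · have h2 := h1 τ
    rw [hr] at h2
    exact absurd (self_eq_neg.mp h2) (h.root_ne_zero τ)

theorem S_smul_I : ModularGroup.S • UpperHalfPlane.I = UpperHalfPlane.I := by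
  rw [ModularGroup.stabilizer_I]
  simp

theorem S_root_I_sq : S.root UpperHalfPlane.I ^ 2 = Complex.I := by
  rw [S.root_sq]
  simp [S, ModularGroup.S]

theorem S_pow_four_mat : (S ^ 4).mat = 1 := by
  change matHom (S ^ 4) = 1
  rw [map_pow]
  change ModularGroup.S ^ 4 = 1
  ext i j
  fin_cases i <;> fin_cases j <;> decide

theorem S_pow_four_root_I : (S ^ 4).root UpperHalfPlane.I = -1 := by
  have h1 : S.mat • UpperHalfPlane.I = UpperHalfPlane.I := S_smul_I
  have h2 : (S * S).mat • UpperHalfPlane.I = UpperHalfPlane.I := by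
    rw [mul_mat, mul_smul, h1, h1]
  have h3 : S ^ 4 = (S * S) * (S * S) := by simp [pow_succ, mul_assoc]
  rw [h3, mul_root, h2, mul_root, h1, ← sq (S.root _), S_root_I_sq, Complex.I_mul_I]

theorem S_pow_eight : S ^ 8 = 1 := by
  have h3 : S ^ 8 = S ^ 4 * S ^ 4 := by group
  refine ext_of_root_eq ?_ UpperHalfPlane.I ?_
  · rw [h3, mul_mat, S_pow_four_mat, one_mul, one_mat]
  · rw [h3, mul_root, S_pow_four_mat, one_smul, S_pow_four_root_I]
    simp

/-- The braid relation. Both sides lie over `-1`, so it suffices to compare their roots at the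
fixed point `ρ = exp(2πi/3)` of `ST`; there the claim is `√ρ = ρ + 1`. -/
theorem S_sq_eq : S ^ 2 = (S * T) ^ 3 := by
  obtain ⟨τ, hτ⟩ : ∃ τ : ℍ, (τ : ℂ) = ⟨-1 / 2, Real.sqrt 3 / 2⟩ :=
    ⟨⟨⟨-1 / 2, Real.sqrt 3 / 2⟩, by simp⟩, rfl⟩
  have h3 : (Real.sqrt 3) * Real.sqrt 3 = 3 := Real.mul_self_sqrt (by norm_num)
  have hsq : (τ : ℂ) = ((τ : ℂ) + 1) ^ 2 := by
    rw [hτ, sq]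
    apply Complex.ext
    · simp; nlinarith
    · simp; ring
  have hcube : (τ : ℂ) * ((τ : ℂ) + 1) = -1 := by
    linear_combination (-1 : ℂ) * hsq
  have h0 : (τ : ℂ) ≠ 0 := UpperHalfPlane.ne_zero τ
  have hT : ((T.mat • τ : ℍ) : ℂ) = τ + 1 := by
    rw [UpperHalfPlane.coe_specialLinearGroup_apply]
    simp [T, ModularGroup.T]
  have hST : (S * T).mat • τ = τ := by
    apply UpperHalfPlane.ext
    rw [mul_mat, mul_smul, UpperHalfPlane.coe_specialLinearGroup_apply, hT]
    have h1 : (τ : ℂ) + 1 ≠ 0 := right_ne_zero_of_mul (a := (τ : ℂ)) (by rw [hcube]; norm_num)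
    simp [S, ModularGroup.S]
    field_simp
    linear_combination (-1 : ℂ) * hcube
  have hS : ((S.mat • τ : ℍ) : ℂ) = τ + 1 := by
    rw [UpperHalfPlane.coe_specialLinearGroup_apply]
    simp [S, ModularGroup.S]
    field_simp
    linear_combination (-1 : ℂ) * hcube
  have hroot : S.root τ = τ + 1 := by
    change (τ : ℂ) ^ (1 / 2 : ℂ) = τ + 1
    rw [one_div, hsq, Complex.sq_cpow_two_inv, ← hsq]
    rw [hτ]
    simp
    norm_num
  have hrT : (S * T).root τ = ((τ : ℂ) + 1) ^ (1 / 2 : ℂ) := by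
    rw [mul_root]
    change ((T.mat • τ : ℍ) : ℂ) ^ (1 / 2 : ℂ) * 1 = _
    rw [hT, mul_one]
  have hrS : (S ^ 2).root τ = ((τ : ℂ) + 1) ^ (1 / 2 : ℂ) * (τ + 1) := by
    rw [sq, mul_root, hroot]
    change ((S.mat • τ : ℍ) : ℂ) ^ (1 / 2 : ℂ) * _ = _
    rw [hS]
  refine ext_of_root_eq ?_ τ ?_
  · change matHom (S ^ 2) = matHom ((S * T) ^ 3)
    simp only [map_pow, map_mul]
    change ModularGroup.S ^ 2 = (ModularGroup.S * ModularGroup.T) ^ 3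
    ext i j
    fin_cases i <;> fin_cases j <;> decide
  · rw [hrS, pow_succ, sq, mul_root, mul_root, hST, hST, hrT]
    have h4 : (((τ : ℂ) + 1) ^ (1 / 2 : ℂ)) ^ 2 = τ + 1 := by
      rw [← Complex.cpow_nat_mul]
      simp
    linear_combination (-(((τ : ℂ) + 1) ^ (1 / 2 : ℂ))) * h4

theorem closure_S_T : Subgroup.closure {S, T} = ⊤ := by
  rw [eq_top_iff]
  intro g _
  have h1 : g.mat ∈ (Subgroup.closure {S, T}).map matHom := by
    rw [MonoidHom.map_closure, Set.image_pair]
    change g.mat ∈ Subgroup.closure {ModularGroup.S, ModularGroup.T}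
    rw [SpecialLinearGroup.SL2Z_generators]
    trivial
  obtain ⟨h, hh, hm⟩ := h1
  rcases root_eq_or_eq_neg (g := h) (h := g) hm with h2 | h2
  · rwa [← Metaplectic.ext hm (funext h2)]
  · have h3 : S ^ 4 * h = g := by
      have hm4 : (S ^ 4 * h).mat = g.mat := by
        rw [mul_mat, S_pow_four_mat, one_mul]; exact hm
      rcases root_eq_or_eq_neg (g := S ^ 4) (h := 1) S_pow_four_mat with h4 | h4
      · have := h4 UpperHalfPlane.I
        rw [S_pow_four_root_I, one_root] at this
        norm_num at this
      · refine ext_of_root_eq hm4 UpperHalfPlane.I ?_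
        rw [mul_root, h4, h2]
        simp
    rw [← h3]
    exact mul_mem (pow_mem (Subgroup.subset_closure (by simp)) 4) hh

section Presentation

variable {K : Type*} [Group K] {s t : K}

theorem commute_sq_of_braid (h : s ^ 2 = (s * t) ^ 3) : Commute (s ^ 2) t := by
  have h1 : Commute (s ^ 2) (s * t) := by
    rw [h]; exact (Commute.refl _).pow_left 3
  have h2 : Commute (s ^ 2) s := (Commute.refl _).pow_left 2
  have h3 := h2.inv_right.mul_right h1
  rwa [inv_mul_cancel_left] at h3

/-- The normal form for words in two generators with `s² = (st)³`: with `u = st`, every element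
is a power of `s²` times a product `x p y`, where `x` is a power of `u`, where `p` is a product of
the elements `t` and `s t⁻¹ s⁻¹`, and where `y` is `1` or `s`. -/
theorem exists_normal_form (h : s ^ 2 = (s * t) ^ 3) {g : K} (hg : g ∈ Subgroup.closure {s, t}) :
    ∃ k : ℤ, ∃ x ∈ ({1, s * t, (s * t)⁻¹} : Set K),
      ∃ p ∈ Submonoid.closure {t, s * t⁻¹ * s⁻¹}, ∃ y ∈ ({1, s} : Set K),
        g = (s ^ 2) ^ k * (x * p * y) := by
  set z := s ^ 2 with hz
  set u := s * t with hu
  set N : K → Prop := fun g => ∃ k : ℤ, ∃ x ∈ ({1, u, u⁻¹} : Set K),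
      ∃ p ∈ Submonoid.closure {t, s * t⁻¹ * s⁻¹}, ∃ y ∈ ({1, s} : Set K),
        g = z ^ k * (x * p * y) with hN
  have cs : Commute z s := (Commute.refl _).pow_left 2
  have ct : Commute z t := commute_sq_of_braid h
  have ht : t ∈ Submonoid.closure {t, s * t⁻¹ * s⁻¹} := Submonoid.subset_closure (by simp)
  have hl : s * t⁻¹ * s⁻¹ ∈ Submonoid.closure {t, s * t⁻¹ * s⁻¹} :=
    Submonoid.subset_closure (by simp)
  have Nz : ∀ (k : ℤ) (g : K), N g → N (z ^ k * g) := by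
    rintro k g ⟨k', x, hx, p, hp, y, hy, rfl⟩
    exact ⟨k + k', x, hx, p, hp, y, hy, by rw [zpow_add, mul_assoc (z ^ k)]⟩
  have Ns : ∀ g, N g → N (s * g) := by
    rintro g ⟨k, x, hx, p, hp, y, hy, rfl⟩
    have e : s * (z ^ k * (x * p * y)) = z ^ k * (s * (x * p * y)) := by
      rw [← mul_assoc, (cs.symm.zpow_right k).eq, mul_assoc]
    rw [e]
    apply Nz
    rcases hx with rfl | rfl | rfl
    · rw [one_mul]
      induction hp using Submonoid.closure_induction_left with
      | one =>
        rcases hy with rfl | rfl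
        · exact ⟨0, 1, by simp, 1, one_mem _, s, by simp, by simp⟩
        · exact ⟨1, 1, by simp, 1, one_mem _, 1, by simp, by simp [hz, sq]⟩
      | mul_left a ha p hp _ =>
        rcases ha with rfl | rfl
        · exact ⟨0, u, by simp, p, hp, y, hy, by simp [hu, mul_assoc]⟩
        · refine ⟨1, u⁻¹, by simp, p, hp, y, hy, ?_⟩
          simp [hz, hu, sq, mul_assoc]
    · exact ⟨1, 1, by simp, t * p, mul_mem ht hp, y, hy, by simp [hz, hu, sq, mul_assoc]⟩
    · exact ⟨0, 1, by simp, s * t⁻¹ * s⁻¹ * p, mul_mem hl hp, y, hy, by rw [hu]; group⟩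
  have Nu : ∀ g, N g → N (u * g) := by
    rintro g ⟨k, x, hx, p, hp, y, hy, rfl⟩
    have e : u * (z ^ k * (x * p * y)) = z ^ k * (u * (x * p * y)) := by
      rw [← mul_assoc, ((cs.mul_right ct).symm.zpow_right k).eq, mul_assoc]
    rw [e]
    apply Nz
    rcases hx with rfl | rfl | rfl
    · exact ⟨0, u, by simp, p, hp, y, hy, by simp [mul_assoc]⟩
    · refine ⟨1, u⁻¹, by simp, p, hp, y, hy, ?_⟩
      simp [h, pow_succ, mul_assoc]
    · exact ⟨0, 1, by simp, p, hp, y, hy, by group⟩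
  have Ns' : ∀ g, N g → N (s⁻¹ * g) := fun g hg => by
    have : s⁻¹ * g = z ^ (-1 : ℤ) * (s * g) := by rw [hz]; group
    rw [this]
    exact Nz _ _ (Ns _ hg)
  have Nu' : ∀ g, N g → N (u⁻¹ * g) := fun g hg => by
    have : u⁻¹ * g = z ^ (-1 : ℤ) * (u * (u * g)) := by rw [h]; group
    rw [this]
    exact Nz _ _ (Nu _ (Nu _ hg))
  change N g
  induction hg using Subgroup.closure_induction_left with
  | one => exact ⟨0, 1, by simp, 1, one_mem _, 1, by simp, by simp⟩
  | mul_left a ha b _ hb =>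
    rcases ha with rfl | rfl
    · exact Ns _ hb
    · have e : a * b = s⁻¹ * (u * b) := by rw [hu]; group
      rw [e]
      exact Ns' _ (Nu _ hb)
  | inv_mul_cancel a ha b _ hb =>
    rcases ha with rfl | rfl
    · exact Ns' _ hb
    · have e : a⁻¹ * b = u⁻¹ * (s * b) := by rw [hu]; group
      rw [e]
      exact Nu' _ (Ns _ hb)

/-- A nonempty product of the matrices `[1, 1; 0, 1]` and `[1, 0; 1, 1]` has nonnegative entries,
positive diagonal, and a nonzero off-diagonal entry. -/
theorem eq_one_or_entries {φ : K →* SL(2, ℤ)} (hs : φ s = ModularGroup.S)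
    (ht : φ t = ModularGroup.T) {p : K} (hp : p ∈ Submonoid.closure {t, s * t⁻¹ * s⁻¹}) :
    (1 ≤ φ p 0 0 ∧ 0 ≤ φ p 0 1 ∧ 0 ≤ φ p 1 0 ∧ 1 ≤ φ p 1 1) ∧
      (p = 1 ∨ 1 ≤ φ p 0 1 + φ p 1 0) := by
  have hl : (φ (s * t⁻¹ * s⁻¹) : Matrix (Fin 2) (Fin 2) ℤ) = !![1, 0; 1, 1] := by
    rw [map_mul, map_mul, map_inv, map_inv, hs, ht]
    ext i j
    fin_cases i <;> fin_cases j <;> decide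
  induction hp using Submonoid.closure_induction_left with
  | one => simp
  | mul_left a ha p _ ih =>
    obtain ⟨⟨h1, h2, h3, h4⟩, -⟩ := ih
    rcases ha with rfl | rfl
    · simp only [map_mul, Matrix.SpecialLinearGroup.coe_mul, ht, ModularGroup.coe_T,
        Matrix.mul_apply, Fin.sum_univ_two]
      simp
      omega
    · rw [map_mul, Matrix.SpecialLinearGroup.coe_mul, hl]
      simp only [Matrix.mul_apply, Fin.sum_univ_two]
      simp
      omega

/-- If `s² = (st)³` and `s⁸ = 1`, then an element of `⟨s, t⟩` that acts trivially under a map to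
`Mp₂(ℤ)` sending `s, t` to `S, T` is trivial: in its normal form the positive word must be empty,
and the remaining power of `s²` is detected by the order `8` of `S`. -/
theorem eq_one_of_map_eq_one (h : s ^ 2 = (s * t) ^ 3) (h8 : s ^ 8 = 1) {φ : K →* Metaplectic}
    (hs : φ s = S) (ht : φ t = T) {g : K} (hg : g ∈ Subgroup.closure {s, t}) (h1 : φ g = 1) :
    g = 1 := by
  obtain ⟨k, x, hx, p, hp, y, hy, rfl⟩ := exists_normal_form h hg
  set ψ : K →* SL(2, ℤ) := matHom.comp φ with hψ
  have ψs : ψ s = ModularGroup.S := by simp [hψ, hs, S]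
  have ψt : ψ t = ModularGroup.T := by simp [hψ, ht, T]
  obtain ⟨⟨pa, pb, pc, pd⟩, hp1⟩ := eq_one_or_entries ψs ψt hp
  have hz : ψ (s ^ 2) = -1 := by
    rw [map_pow, ψs]
    ext i j
    fin_cases i <;> fin_cases j <;> decide
  have hm : ψ (s ^ 2) ^ k * (ψ x * ψ p * ψ y) = 1 := by
    have := congrArg matHom h1
    rw [map_one] at this
    rw [← this, ← map_zpow, ← map_mul, ← map_mul, ← map_mul]
    rfl
  have hm2 : ψ x * ψ p * ψ y = 1 ∨ ψ x * ψ p * ψ y = -1 := by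
    rw [hz] at hm
    rcases Int.even_or_odd k with hk | hk
    · left; rwa [hk.neg_one_zpow, one_mul] at hm
    · right
      rw [hk.neg_one_zpow] at hm
      rw [← neg_eq_iff_eq_neg, ← hm, neg_one_mul]
  have hm3 : (∀ i j, (ψ x * ψ p * ψ y) i j = (1 : Matrix (Fin 2) (Fin 2) ℤ) i j) ∨
      ∀ i j, (ψ x * ψ p * ψ y) i j = (-1 : Matrix (Fin 2) (Fin 2) ℤ) i j := by
    rcases hm2 with e | e
    · left; intro i j; rw [e]; simp
    · right; intro i j; rw [e]; simp
  have ψu : (ψ (s * t) : Matrix (Fin 2) (Fin 2) ℤ) = !![0, -1; 1, 1] := by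
    rw [map_mul, ψs, ψt]
    ext i j
    fin_cases i <;> fin_cases j <;> decide
  have ψu' : (ψ (s * t)⁻¹ : Matrix (Fin 2) (Fin 2) ℤ) = !![1, 1; -1, 0] := by
    rw [map_inv, map_mul, ψs, ψt]
    ext i j
    fin_cases i <;> fin_cases j <;> decide
  have key : x = 1 ∧ y = 1 ∧ p = 1 := by
    simp only [Fin.forall_fin_two, Matrix.SpecialLinearGroup.coe_mul, Matrix.mul_apply,
      Fin.sum_univ_two] at hm3
    rcases hx with rfl | rfl | rfl <;> rcases hy with rfl | rfl <;>
      simp [ψs, ψu, ψu', ModularGroup.coe_S, -map_mul, -map_inv, -mul_inv_rev] at hm3 <;>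
      first
      | (exfalso; omega)
      | exact ⟨rfl, rfl, hp1.resolve_right (by omega)⟩
  obtain ⟨rfl, rfl, rfl⟩ := key
  simp only [mul_one] at h1 hm ⊢
  have hz4 : (s ^ 2) ^ (4 : ℤ) = 1 := by
    rw [← h8, zpow_ofNat, ← pow_mul]
  have hk : k % 4 = 0 := by
    have e2 : (S ^ 2) ^ k = 1 := by
      rw [← h1, map_zpow, map_pow, hs]
    have hS4 : (S ^ 2) ^ (4 : ℤ) = 1 := by
      rw [← S_pow_eight, zpow_ofNat, ← pow_mul]
    have hmod : (S ^ 2) ^ (k % 4) = 1 := by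
      rw [← Int.emod_add_mul_ediv k 4, zpow_add, zpow_mul, hS4, one_zpow, mul_one] at e2
      exact e2
    have hlt : k % 4 = 0 ∨ k % 4 = 1 ∨ k % 4 = 2 ∨ k % 4 = 3 := by omega
    have hmS : matHom (S ^ 2) = -1 := by rw [← hz, hψ, MonoidHom.comp_apply, map_pow φ, hs]
    have hne : (-1 : SL(2, ℤ)) ≠ 1 := by
      intro e
      have := congrArg (fun A : SL(2, ℤ) => A 0 0) e
      simp at this
    rcases hlt with e | e | e | e
    · exact e
    · rw [e] at hmod
      have := congrArg matHom hmod
      rw [map_zpow, hmS, map_one] at this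
      exact absurd (by simpa using this) hne
    · rw [e, show (2 : ℤ) = (2 : ℕ) by rfl, zpow_natCast, ← pow_mul, show 2 * 2 = 4 by rfl] at hmod
      have := congrArg (fun g : Metaplectic => g.root UpperHalfPlane.I) hmod
      simp only [S_pow_four_root_I, one_root] at this
      norm_num at this
    · rw [e] at hmod
      have := congrArg matHom hmod
      rw [map_zpow, hmS, map_one, Odd.neg_one_zpow (by decide)] at this
      exact absurd this hne
  rw [← Int.emod_add_mul_ediv k 4, hk, zero_add, zpow_mul, hz4, one_zpow]

end Presentation

/-- The universal property of the presentation `⟨S, T | S² = (ST)³, S⁸ = 1⟩` of `Mp₂(ℤ)`. -/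
theorem exists_hom {H : Type*} [Group H] {s t : H} (h : s ^ 2 = (s * t) ^ 3) (h8 : s ^ 8 = 1) :
    ∃ φ : Metaplectic →* H, φ S = s ∧ φ T = t := by
  -- The subgroup of `Mp₂(ℤ) × H` generated by `(S, s)` and `(T, t)` is the graph of `φ`.
  set a : Metaplectic × H := (S, s) with ha
  set b : Metaplectic × H := (T, t) with hb
  set G := Subgroup.closure {a, b} with hG
  have hab : a ^ 2 = (a * b) ^ 3 := Prod.ext S_sq_eq h
  have hab8 : a ^ 8 = 1 := Prod.ext S_pow_eight h8
  set π : G →* Metaplectic := (MonoidHom.fst Metaplectic H).comp G.subtype with hπ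
  have hinj : Function.Injective π := by
    rw [injective_iff_map_eq_one]
    intro g hg
    exact Subtype.ext (eq_one_of_map_eq_one (φ := MonoidHom.fst Metaplectic H) hab hab8 rfl rfl
      g.2 hg)
  have hsurj : Function.Surjective π := by
    rw [← MonoidHom.range_eq_top, hπ, MonoidHom.range_comp, Subgroup.range_subtype, hG,
      MonoidHom.map_closure, Set.image_pair]
    exact closure_S_T
  set e := MulEquiv.ofBijective π ⟨hinj, hsurj⟩ with he
  refine ⟨((MonoidHom.snd Metaplectic H).comp G.subtype).comp e.symm.toMonoidHom, ?_, ?_⟩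
  · have h1 : e.symm S = ⟨a, Subgroup.subset_closure (by simp)⟩ := by
      rw [MulEquiv.symm_apply_eq]; rfl
    simp [h1, ha]
  · have h1 : e.symm T = ⟨b, Subgroup.subset_closure (by simp)⟩ := by
      rw [MulEquiv.symm_apply_eq]; rfl
    simp [h1, hb]

end Metaplectic

/-! ### The character `e` and orthogonality relations -/

theorem eChar_coe (q : ℚ) :
    eChar (q : AddCircle (1 : ℚ)) = Complex.exp (2 * Real.pi * Complex.I * (q : ℂ)) := rfl

theorem eChar_zero : eChar 0 = 1 := by
  rw [← AddCircle.coe_zero, eChar_coe]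
  simp

theorem eChar_add (a b : AddCircle (1 : ℚ)) : eChar (a + b) = eChar a * eChar b := by
  induction a using QuotientAddGroup.induction_on with
  | H a =>
    induction b using QuotientAddGroup.induction_on with
    | H b =>
      change eChar ((a : AddCircle (1 : ℚ)) + (b : AddCircle (1 : ℚ))) =
        eChar (a : AddCircle (1 : ℚ)) * eChar (b : AddCircle (1 : ℚ))
      rw [← AddCircle.coe_add, eChar_coe, eChar_coe, eChar_coe, ← Complex.exp_add]
      push_cast
      ring_nf

theorem norm_eChar (a : AddCircle (1 : ℚ)) : ‖eChar a‖ = 1 := by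
  induction a using QuotientAddGroup.induction_on with
  | H a =>
    rw [eChar_coe, show (2 * Real.pi * Complex.I * (a : ℂ)) =
      ((2 * Real.pi * a : ℝ) : ℂ) * Complex.I by push_cast; ring]
    exact Complex.norm_exp_ofReal_mul_I _

theorem eChar_eq_one_iff {a : AddCircle (1 : ℚ)} : eChar a = 1 ↔ a = 0 := by
  refine ⟨fun h => ?_, fun h => by rw [h, eChar_zero]⟩
  induction a using QuotientAddGroup.induction_on with
  | H a =>
    change eChar (a : AddCircle (1 : ℚ)) = 1 at h
    rw [eChar_coe, Complex.exp_eq_one_iff] at h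
    obtain ⟨n, hn⟩ := h
    have h2 : (a : ℂ) = n := by
      have h3 : (2 * Real.pi * Complex.I : ℂ) ≠ 0 := Complex.two_pi_I_ne_zero
      apply mul_left_cancel₀ h3
      rw [hn]; ring
    have h4 : a = n := by exact_mod_cast h2
    change (a : AddCircle (1 : ℚ)) = 0
    rw [AddCircle.coe_eq_zero_iff]
    exact ⟨n, by simp [h4]⟩

theorem eChar_neg (a : AddCircle (1 : ℚ)) : eChar (-a) = (starRingEnd ℂ) (eChar a) := by
  have h : eChar (-a) * eChar a = 1 := by rw [← eChar_add, neg_add_cancel, eChar_zero]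
  rw [eq_comm, ← Complex.inv_eq_conj (norm_eChar a)]
  exact inv_eq_of_mul_eq_one_left h

/-- `e` as an additive character. -/
def eAddChar : AddChar (AddCircle (1 : ℚ)) ℂ where
  toFun := eChar
  map_zero_eq_one' := eChar_zero
  map_add_eq_mul' := eChar_add

-- Finite modules carry only a `Finite` instance; sums and case distinctions are classical.
attribute [local instance 10] Fintype.ofFinite
attribute [local instance 10] Classical.propDecidable

theorem sum_eChar_hom {A : Type*} [AddCommGroup A] [Fintype A] (φ : A →+ AddCircle (1 : ℚ)) :
    ∑ a, eChar (φ a) = if ∀ a, φ a = 0 then (Nat.card A : ℂ) else 0 := by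
  have h := AddChar.sum_eq_ite (eAddChar.compAddMonoidHom φ)
  have h2 : eAddChar.compAddMonoidHom φ = 0 ↔ ∀ a, φ a = 0 := by
    rw [AddChar.eq_zero_iff]
    exact forall_congr' fun a => eChar_eq_one_iff
  simp only [h2, ← Nat.card_eq_fintype_card] at h
  exact h

section QuadraticModule

variable {M : Type*} [AddCommGroup M]

/-- Nondegeneracy of the bilinear form of `Q`. -/
def IsNondegenerate (Q : QuadraticMap ℤ M (AddCircle (1 : ℚ))) : Prop :=
  ∀ x, (∀ y, QuadraticMap.polar Q x y = 0) → x = 0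

/-- The orthogonal complement of `U` with respect to the bilinear form of `Q`. -/
def orth (Q : QuadraticMap ℤ M (AddCircle (1 : ℚ))) (U : AddSubgroup M) : AddSubgroup M where
  carrier := {x | ∀ u ∈ U, QuadraticMap.polar Q x u = 0}
  zero_mem' u _ := by simp
  add_mem' {x y} hx hy u hu := by rw [QuadraticMap.polar_add_left, hx u hu, hy u hu, add_zero]
  neg_mem' {x} hx u hu := by rw [QuadraticMap.polar_neg_left, hx u hu, neg_zero]

/-- `U` is isotropic: the quadratic form itself vanishes on `U`. -/
def IsIsotropic (Q : QuadraticMap ℤ M (AddCircle (1 : ℚ))) (U : AddSubgroup M) : Prop :=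
  ∀ u ∈ U, Q u = 0

variable {Q : QuadraticMap ℤ M (AddCircle (1 : ℚ))}

theorem mem_orth {U : AddSubgroup M} {x : M} :
    x ∈ orth Q U ↔ ∀ u ∈ U, QuadraticMap.polar Q x u = 0 := Iff.rfl

theorem mem_orth_closure {X : Set M} {x : M} :
    x ∈ orth Q (AddSubgroup.closure X) ↔ ∀ u ∈ X, QuadraticMap.polar Q x u = 0 := by
  refine ⟨fun h u hu => h u (AddSubgroup.subset_closure hu), fun h u hu => ?_⟩
  induction hu using AddSubgroup.closure_induction with
  | mem u hu => exact h u hu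
  | zero => simp
  | add u v _ _ hu hv => rw [QuadraticMap.polar_add_right, hu, hv, add_zero]
  | neg u _ hu => rw [QuadraticMap.polar_neg_right, hu, neg_zero]

theorem form_add (x y : M) : Q (x + y) = Q x + Q y + QuadraticMap.polar Q x y :=
  QuadraticMap.map_add Q x y

theorem IsIsotropic.le_orth {U : AddSubgroup M} (hU : IsIsotropic Q U) : U ≤ orth Q U := by
  intro x hx u hu
  have h := form_add (Q := Q) x u
  rw [hU x hx, hU u hu, hU _ (add_mem hx hu)] at h
  simpa using h.symm

/-- The homomorphism `y ↦ B(x, y)`. -/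
def polarHom (Q : QuadraticMap ℤ M (AddCircle (1 : ℚ))) (x : M) : M →+ AddCircle (1 : ℚ) :=
  (Q.polarBilin x).toAddMonoidHom

@[simp] theorem polarHom_apply (x y : M) : polarHom Q x y = QuadraticMap.polar Q x y := rfl

theorem polar_self_eq (x : M) : QuadraticMap.polar Q x x = (2 : ℤ) • Q x := by
  rw [QuadraticMap.polar_self]
  simp [two_smul]

theorem form_zsmul (a : ℤ) (x : M) : Q (a • x) = (a * a) • Q x := QuadraticMap.map_smul Q a x

theorem polar_zsmul_left (a : ℤ) (x y : M) :
    QuadraticMap.polar Q (a • x) y = a • QuadraticMap.polar Q x y :=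
  QuadraticMap.polar_smul_left Q a x y

theorem polar_zsmul_right (a : ℤ) (x y : M) :
    QuadraticMap.polar Q x (a • y) = a • QuadraticMap.polar Q x y :=
  QuadraticMap.polar_smul_right Q a x y

theorem polar_symm (x y : M) : QuadraticMap.polar Q x y = QuadraticMap.polar Q y x :=
  QuadraticMap.polar_comm Q x y

theorem two_card_smul_form (Q : QuadraticMap ℤ M (AddCircle (1 : ℚ))) (x : M) :
    (2 * Nat.card M : ℤ) • Q x = 0 := by
  rw [mul_comm, mul_smul, ← polar_self_eq, ← polar_zsmul_left, natCast_zsmul, card_nsmul_eq_zero',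
    QuadraticMap.polar_zero_left]

/-! ### Gauss sums and orthogonal complements -/

/-- The absolute value of a Gauss sum is determined by the radical. -/
theorem gauss_mul_conj [Fintype M] (Q : QuadraticMap ℤ M (AddCircle (1 : ℚ))) :
    (∑ x, eChar (-Q x)) * (starRingEnd ℂ) (∑ x, eChar (-Q x)) =
      Nat.card M * ∑ z, if ∀ y, QuadraticMap.polar Q z y = 0 then eChar (-Q z) else 0 := by
  rw [map_sum, Finset.sum_mul_sum, Finset.sum_comm, Finset.mul_sum]
  have h1 : ∀ y : M, ∑ x, eChar (-Q x) * (starRingEnd ℂ) (eChar (-Q y)) =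
      ∑ z, eChar (-Q z) * eChar (QuadraticMap.polar Q (-z) y) := by
    intro y
    rw [← Equiv.sum_comp (Equiv.addRight y)]
    refine Finset.sum_congr rfl fun z _ => ?_
    rw [← eChar_neg, ← eChar_add, ← eChar_add, Equiv.coe_addRight, form_add,
      QuadraticMap.polar_neg_left]
    congr 1
    abel
  simp only [h1]
  rw [Finset.sum_comm]
  refine Finset.sum_congr rfl fun z _ => ?_
  rw [← Finset.mul_sum]
  have h := sum_eChar_hom (polarHom Q (-z))
  simp only [polarHom_apply] at h
  rw [h]
  simp only [QuadraticMap.polar_neg_left, neg_eq_zero]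
  split_ifs <;> ring

theorem gauss_norm_sq_le [Fintype M] (Q : QuadraticMap ℤ M (AddCircle (1 : ℚ))) {r : ℕ}
    (hr : Nat.card {z : M // ∀ y, QuadraticMap.polar Q z y = 0} ≤ r) :
    ‖∑ x, eChar (-Q x)‖ ^ 2 ≤ Nat.card M * r := by
  have h := congrArg norm (gauss_mul_conj Q)
  rw [norm_mul, RCLike.norm_conj, ← sq, norm_mul] at h
  rw [h, Complex.norm_natCast]
  refine mul_le_mul_of_nonneg_left ?_ (Nat.cast_nonneg _)
  refine (norm_sum_le _ _).trans ?_
  have h2 : ∀ z : M, ‖(if ∀ y, QuadraticMap.polar Q z y = 0 then eChar (-Q z) else 0 : ℂ)‖ =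
      if ∀ y, QuadraticMap.polar Q z y = 0 then 1 else 0 := by
    intro z
    split_ifs
    · exact norm_eChar _
    · simp
  simp only [h2]
  rw [Finset.sum_boole, ← Fintype.card_subtype, ← Nat.card_eq_fintype_card]
  exact_mod_cast hr

variable [Finite M]

theorem sum_eChar_polar (hQ : IsNondegenerate Q) (x : M) :
    ∑ y, eChar (QuadraticMap.polar Q x y) = if x = 0 then (Nat.card M : ℂ) else 0 := by
  have h := sum_eChar_hom (polarHom Q x)
  simp only [polarHom_apply] at h
  rw [h]
  refine if_congr ⟨hQ x, fun hx y => by simp [hx]⟩ rfl rfl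

theorem sum_eChar_polar_subgroup (U : AddSubgroup M) (x : M) :
    ∑ u : U, eChar (QuadraticMap.polar Q x u) =
      if x ∈ orth Q U then (Nat.card U : ℂ) else 0 := by
  have h := sum_eChar_hom ((polarHom Q x).comp U.subtype)
  simp only [AddMonoidHom.comp_apply, polarHom_apply, AddSubgroup.subtype_apply] at h
  rw [h]
  refine if_congr ?_ rfl rfl
  simp [mem_orth]

theorem card_mul_card_orth (hQ : IsNondegenerate Q) (U : AddSubgroup M) :
    Nat.card U * Nat.card (orth Q U) = Nat.card M := by
  have h1 : ∑ x : M, ∑ u : U, eChar (QuadraticMap.polar Q x u) =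
      (Nat.card U * Nat.card (orth Q U) : ℂ) := by
    simp only [sum_eChar_polar_subgroup]
    rw [← Finset.sum_filter, Finset.sum_const, nsmul_eq_mul]
    rw [mul_comm, ← Fintype.card_subtype, ← Nat.card_eq_fintype_card]
  rw [Finset.sum_comm] at h1
  have h2 : ∀ u : U, ∑ x : M, eChar (QuadraticMap.polar Q x u) =
      if u = 0 then (Nat.card M : ℂ) else 0 := by
    intro u
    simp only [polar_symm _ (u : M), sum_eChar_polar hQ, ZeroMemClass.coe_eq_zero]
  simp only [h2] at h1
  rw [Finset.sum_ite_eq' Finset.univ (0 : U)] at h1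
  simp only [Finset.mem_univ, if_true] at h1
  exact_mod_cast h1.symm

theorem orth_orth (hQ : IsNondegenerate Q) (U : AddSubgroup M) : orth Q (orth Q U) = U := by
  have h1 := card_mul_card_orth hQ U
  have h2 := card_mul_card_orth hQ (orth Q U)
  have h3 : U ≤ orth Q (orth Q U) := fun u hu x hx => by rw [polar_symm]; exact hx u hu
  symm
  refine AddSubgroup.eq_of_le_of_card_ge h3 ?_
  have h4 : 0 < Nat.card (orth Q U) := Nat.card_pos
  rw [← h1, mul_comm] at h2
  exact (Nat.eq_of_mul_eq_mul_right h4 h2).le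

theorem gauss_mul_conj_of_nondegenerate (hQ : IsNondegenerate Q) :
    (∑ x, eChar (-Q x)) * (starRingEnd ℂ) (∑ x, eChar (-Q x)) = Nat.card M := by
  rw [gauss_mul_conj, Finset.sum_eq_single 0]
  · simp [eChar_zero]
  · intro z _ hz
    rw [if_neg fun h => hz (hQ z h)]
  · simp

theorem gaussSigma_eq (Q : QuadraticMap ℤ M (AddCircle (1 : ℚ))) :
    gaussSigma Q = ((Real.sqrt (Nat.card M) : ℝ) : ℂ)⁻¹ * ∑ x, eChar (-Q x) := by
  rw [gaussSigma, finsum_eq_sum_of_fintype]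

theorem sqrt_card_sq (M : Type*) :
    ((Real.sqrt (Nat.card M) : ℝ) : ℂ) ^ 2 = Nat.card M := by
  rw [← Complex.ofReal_pow, Real.sq_sqrt (Nat.cast_nonneg _)]
  simp

theorem sqrt_card_ne_zero (M : Type*) [Nonempty M] [Finite M] :
    ((Real.sqrt (Nat.card M) : ℝ) : ℂ) ≠ 0 := by
  have h : 0 < Nat.card M := Nat.card_pos
  rw [Complex.ofReal_ne_zero]
  positivity

theorem sum_eChar_neg_eq (Q : QuadraticMap ℤ M (AddCircle (1 : ℚ))) :
    ∑ x, eChar (-Q x) = ((Real.sqrt (Nat.card M) : ℝ) : ℂ) * gaussSigma Q := by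
  rw [gaussSigma_eq, mul_inv_cancel_left₀ (sqrt_card_ne_zero M)]

theorem sum_eChar_eq (Q : QuadraticMap ℤ M (AddCircle (1 : ℚ))) :
    ∑ x, eChar (Q x) =
      ((Real.sqrt (Nat.card M) : ℝ) : ℂ) * (starRingEnd ℂ) (gaussSigma Q) := by
  have h := congrArg (starRingEnd ℂ) (sum_eChar_neg_eq Q)
  rw [map_sum, map_mul, Complex.conj_ofReal] at h
  rw [← h]
  exact Finset.sum_congr rfl fun x _ => by rw [← eChar_neg, neg_neg]

theorem gaussSigma_mul_conj (hQ : IsNondegenerate Q) :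
    gaussSigma Q * (starRingEnd ℂ) (gaussSigma Q) = 1 := by
  have h := gauss_mul_conj_of_nondegenerate hQ
  rw [sum_eChar_neg_eq, map_mul, Complex.conj_ofReal, ← sqrt_card_sq] at h
  have h0 := sqrt_card_ne_zero M
  apply mul_left_cancel₀ (pow_ne_zero 2 h0)
  linear_combination h

/-- `σ(M)⁸ = 1`. A quaternion with integer coordinates and norm congruent to `-1` modulo `2|M|`
acts on `M⁴` as an isometry between the orthogonal sums of four copies of `Q` and of `-Q`;
therefore `σ(M)⁴` is real. Such a quaternion exists by the four squares theorem. -/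
theorem gaussSigma_pow_eight (hQ : IsNondegenerate Q) : gaussSigma Q ^ 8 = 1 := by
  have hpos : 0 < Nat.card M := Nat.card_pos
  obtain ⟨a', b', c', d', hn⟩ := Nat.sum_four_squares (2 * Nat.card M - 1)
  obtain ⟨a, b, c, d, habcd⟩ : ∃ a b c d : ℤ,
      a * a + b * b + c * c + d * d = 2 * Nat.card M - 1 := by
    refine ⟨a', b', c', d', ?_⟩
    zify [show 1 ≤ 2 * Nat.card M by omega] at hn
    linear_combination hn
  have hM : ∀ x : M, (2 * Nat.card M - 1 : ℤ) • x = -x := by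
    intro x
    have : (Nat.card M : ℤ) • x = 0 := by rw [natCast_zsmul, card_nsmul_eq_zero']
    rw [sub_smul, mul_smul, this, smul_zero, one_smul, zero_sub]
  set f : M × M × M × M → M × M × M × M := fun v =>
    (a • v.1 - b • v.2.1 - c • v.2.2.1 - d • v.2.2.2,
      a • v.2.1 + b • v.1 + c • v.2.2.2 - d • v.2.2.1,
      a • v.2.2.1 - b • v.2.2.2 + c • v.1 + d • v.2.1,
      a • v.2.2.2 + b • v.2.2.1 - c • v.2.1 + d • v.1) with hf
  set g : M × M × M × M → M × M × M × M := fun v =>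
    (a • v.1 + b • v.2.1 + c • v.2.2.1 + d • v.2.2.2,
      a • v.2.1 - b • v.1 - c • v.2.2.2 + d • v.2.2.1,
      a • v.2.2.1 + b • v.2.2.2 - c • v.1 - d • v.2.1,
      a • v.2.2.2 - b • v.2.2.1 + c • v.2.1 - d • v.1) with hg
  have hgf : ∀ v, g (f v) = -v := by
    rintro ⟨x, y, z, w⟩
    rw [hf, hg]
    refine Prod.ext ?_ (Prod.ext ?_ (Prod.ext ?_ ?_))
    · change _ = -x; rw [← hM x, ← habcd]; dsimp only; module
    · change _ = -y; rw [← hM y, ← habcd]; dsimp only; module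
    · change _ = -z; rw [← hM z, ← habcd]; dsimp only; module
    · change _ = -w; rw [← hM w, ← habcd]; dsimp only; module
  have hinj : Function.Injective f := by
    intro v w h
    have := congrArg g h
    rwa [hgf, hgf, neg_inj] at this
  set q : M × M × M × M → AddCircle (1 : ℚ) := fun v =>
    Q v.1 + Q v.2.1 + Q v.2.2.1 + Q v.2.2.2 with hq
  have hqf : ∀ v, q (f v) = -q v := by
    rintro ⟨x, y, z, w⟩
    have h1 : q (f (x, y, z, w)) = (2 * Nat.card M - 1 : ℤ) • q (x, y, z, w) := by
      rw [← habcd, hq, hf]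
      dsimp only
      simp only [sub_eq_add_neg, form_add, QuadraticMap.map_neg, QuadraticMap.polar_add_left,
        QuadraticMap.polar_neg_left, QuadraticMap.polar_neg_right, polar_zsmul_left,
        polar_zsmul_right, form_zsmul]
      rw [polar_symm y x, polar_symm z x, polar_symm w x, polar_symm z y, polar_symm w y,
        polar_symm w z]
      module
    rw [h1, sub_smul, one_smul, hq]
    simp only [smul_add, two_card_smul_form, add_zero, zero_sub]
  set G := ∑ x, eChar (-Q x) with hG
  have hG4 : ∑ v, eChar (-q v) = G ^ 4 := by
    simp only [hq, neg_add, eChar_add, Fintype.sum_prod_type, ← Finset.mul_sum, ← Finset.sum_mul]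
    rw [← hG]
    ring
  have hreal : G ^ 4 = (starRingEnd ℂ) (G ^ 4) := by
    have e := (Equiv.ofBijective f (Finite.injective_iff_bijective.mp hinj)).sum_comp
      (fun v => eChar (-q v))
    simp only [Equiv.ofBijective_apply, hqf] at e
    rw [← hG4, map_sum, ← e]
    exact Finset.sum_congr rfl fun v _ => by rw [eChar_neg]
  have hs : gaussSigma Q ^ 4 = (starRingEnd ℂ) (gaussSigma Q ^ 4) := by
    rw [gaussSigma_eq, ← hG, mul_pow, map_mul, ← hreal, map_pow, map_inv₀, Complex.conj_ofReal]
  calc gaussSigma Q ^ 8 = gaussSigma Q ^ 4 * gaussSigma Q ^ 4 := by ring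
    _ = (gaussSigma Q * (starRingEnd ℂ) (gaussSigma Q)) ^ 4 := by
        nth_rewrite 2 [hs]; rw [map_pow]; ring
    _ = 1 := by rw [gaussSigma_mul_conj hQ, one_pow]

/-- A Gauss sum over `M` is already a sum over the orthogonal complement of any isotropic
subgroup. -/
theorem sum_eq_sum_orth {U : AddSubgroup M} (hU : IsIsotropic Q U) :
    ∑ x, eChar (-Q x) = ∑ x : orth Q U, eChar (-Q x) := by
  have h1 : (Nat.card U : ℂ) * ∑ x, eChar (-Q x) =
      ∑ x, eChar (-Q x) * ∑ u : U, eChar (QuadraticMap.polar Q (-x) u) := by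
    simp only [Finset.mul_sum (s := (Finset.univ : Finset U))]
    rw [Finset.sum_comm, Nat.card_eq_fintype_card, ← nsmul_eq_mul, ← Finset.card_univ,
      ← Finset.sum_const]
    refine Finset.sum_congr rfl fun u _ => ?_
    rw [← Equiv.sum_comp (Equiv.addRight (u : M))]
    refine Finset.sum_congr rfl fun x _ => ?_
    rw [Equiv.coe_addRight, form_add, hU u u.2, ← eChar_add, QuadraticMap.polar_neg_left]
    congr 1
    abel
  simp only [sum_eChar_polar_subgroup, neg_mem_iff, mul_ite, mul_zero] at h1
  rw [← Finset.sum_filter, ← Finset.sum_mul, mul_comm] at h1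
  have h0 : (Nat.card U : ℂ) ≠ 0 := Nat.cast_ne_zero.mpr Nat.card_pos.ne'
  rw [mul_right_cancel₀ h0 h1]
  exact Finset.sum_subtype _ (by simp) _

theorem card_eq_sq_of_orth_eq (hQ : IsNondegenerate Q) {U : AddSubgroup M} (hU : orth Q U = U) :
    Nat.card M = Nat.card U ^ 2 := by
  rw [← card_mul_card_orth hQ U, hU, sq]

/-- A quadratic module with a self-dual isotropic subgroup has `σ = 1`. -/
theorem gaussSigma_eq_one (hQ : IsNondegenerate Q) {U : AddSubgroup M} (hU : IsIsotropic Q U)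
    (hU' : orth Q U = U) : gaussSigma Q = 1 := by
  rw [gaussSigma_eq, sum_eq_sum_orth hU, hU', card_eq_sq_of_orth_eq hQ hU']
  rw [Finset.sum_congr rfl (g := fun _ => (1 : ℂ))
    fun x _ => by rw [hU x x.2, neg_zero, eChar_zero]]
  rw [Finset.sum_const, Finset.card_univ, ← Nat.card_eq_fintype_card, Nat.cast_pow,
    Real.sqrt_sq (Nat.cast_nonneg _), Complex.ofReal_natCast]
  simp

end QuadraticModule

/-! ### The Weil representation -/

section WeilRepresentation

variable {M : Type*} [AddCommGroup M] [Finite M] (Q : QuadraticMap ℤ M (AddCircle (1 : ℚ)))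

/-- The matrix of `(T, 1)` in the Weil representation. -/
def weilT : Matrix M M ℂ := Matrix.diagonal fun x => eChar (Q x)

/-- The matrix of `(S, √τ)` in the Weil representation. -/
def weilS : Matrix M M ℂ := Matrix.of fun y x =>
  gaussSigma Q * ((Real.sqrt (Nat.card M) : ℝ) : ℂ)⁻¹ * eChar (-QuadraticMap.polar Q y x)

theorem weilT_mul_inv : weilT Q * Matrix.diagonal (fun x => eChar (-Q x)) = 1 := by
  rw [weilT, Matrix.diagonal_mul_diagonal, ← Matrix.diagonal_one]
  congr 1
  funext x
  rw [← eChar_add, add_neg_cancel, eChar_zero]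

theorem weilT_inv_mul : Matrix.diagonal (fun x => eChar (-Q x)) * weilT Q = 1 := by
  rw [weilT, Matrix.diagonal_mul_diagonal, ← Matrix.diagonal_one]
  congr 1
  funext x
  rw [← eChar_add, neg_add_cancel, eChar_zero]

variable {Q}

theorem weilS_sq_apply (hQ : IsNondegenerate Q) (z x : M) :
    (weilS Q * weilS Q) z x = if x = -z then gaussSigma Q ^ 2 else 0 := by
  have h0 := sqrt_card_ne_zero M
  have h1 : ∀ y : M, weilS Q z y * weilS Q y x =
      (gaussSigma Q * ((Real.sqrt (Nat.card M) : ℝ) : ℂ)⁻¹) ^ 2 *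
        eChar (QuadraticMap.polar Q (-(x + z)) y) := by
    intro y
    rw [QuadraticMap.polar_neg_left, QuadraticMap.polar_add_left, neg_add, eChar_add, weilS,
      polar_symm x y]
    simp only [Matrix.of_apply]
    ring
  rw [Matrix.mul_apply]
  simp only [h1]
  rw [← Finset.mul_sum, sum_eChar_polar hQ, neg_eq_zero, ← sqrt_card_sq]
  simp only [add_eq_zero_iff_eq_neg]
  split_ifs
  · field_simp
  · simp

theorem weilS_sq_mul_self (hQ : IsNondegenerate Q) :
    (weilS Q * weilS Q) * (weilS Q * weilS Q) = (gaussSigma Q ^ 4) • (1 : Matrix M M ℂ) := by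
  ext z x
  rw [Matrix.mul_apply]
  simp only [weilS_sq_apply hQ, ite_mul, zero_mul]
  rw [Finset.sum_ite_eq' Finset.univ (-z)]
  simp only [Finset.mem_univ, if_true, neg_neg, Matrix.smul_apply, Matrix.one_apply, smul_eq_mul,
    mul_ite, mul_zero, mul_one, eq_comm (a := x)]
  split_ifs <;> ring

theorem weilS_pow_eight (hQ : IsNondegenerate Q) : weilS Q ^ 8 = 1 := by
  have h : weilS Q ^ 8 = ((weilS Q * weilS Q) * (weilS Q * weilS Q)) *
      ((weilS Q * weilS Q) * (weilS Q * weilS Q)) := by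
    simp only [pow_succ, pow_zero, one_mul, mul_assoc]
  rw [h, weilS_sq_mul_self hQ, smul_mul_smul_comm, one_mul, ← pow_add, gaussSigma_pow_eight hQ,
    one_smul]

theorem weilS_sq_comm (hQ : IsNondegenerate Q) :
    (weilS Q * weilS Q) * weilT Q = weilT Q * (weilS Q * weilS Q) := by
  ext z x
  rw [weilT, Matrix.mul_diagonal, Matrix.diagonal_mul, weilS_sq_apply hQ]
  split_ifs with h
  · rw [h, QuadraticMap.map_neg, mul_comm]
  · simp

/-- The braid relation, by completing the square in a Gauss sum. -/
theorem weilS_mul_weilT_mul_weilS (hQ : IsNondegenerate Q) :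
    weilS Q * weilT Q * weilS Q = Matrix.diagonal (fun x => eChar (-Q x)) * weilS Q *
      Matrix.diagonal (fun x => eChar (-Q x)) := by
  have h0 := sqrt_card_ne_zero M
  ext z x
  have h1 : ∀ y : M, (weilS Q * weilT Q) z y * weilS Q y x =
      (gaussSigma Q * ((Real.sqrt (Nat.card M) : ℝ) : ℂ)⁻¹) ^ 2 * eChar (-Q (x + z)) *
        eChar (Q (y + -(x + z))) := by
    intro y
    have h2 : -QuadraticMap.polar Q z y + Q y + -QuadraticMap.polar Q y x =
        -Q (x + z) + Q (y + -(x + z)) := by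
      rw [form_add y, QuadraticMap.map_neg, QuadraticMap.polar_neg_right,
        QuadraticMap.polar_add_right, polar_symm z y]
      abel
    rw [mul_assoc _ (eChar _), ← eChar_add, ← h2, eChar_add, eChar_add, weilT,
      Matrix.mul_diagonal, weilS]
    simp only [Matrix.of_apply]
    ring
  rw [Matrix.mul_apply]
  simp only [h1]
  have h3 : ∑ y : M, eChar (Q (y + -(x + z))) = ∑ y, eChar (Q y) :=
    Equiv.sum_comp (Equiv.addRight (-(x + z))) (fun y => eChar (Q y))
  rw [← Finset.mul_sum, h3, sum_eChar_eq, Matrix.mul_diagonal, Matrix.diagonal_mul, form_add,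
    neg_add, neg_add, eChar_add, eChar_add, polar_symm x z, weilS]
  simp only [Matrix.of_apply]
  have hσ := gaussSigma_mul_conj hQ
  have h4 : ((Real.sqrt (Nat.card M) : ℝ) : ℂ)⁻¹ * ((Real.sqrt (Nat.card M) : ℝ) : ℂ) = 1 :=
    inv_mul_cancel₀ h0
  linear_combination (gaussSigma Q * ((Real.sqrt (Nat.card M) : ℝ) : ℂ)⁻¹ * eChar (-Q x) *
    eChar (-Q z) * eChar (-QuadraticMap.polar Q z x)) *
      ((gaussSigma Q * (starRingEnd ℂ) (gaussSigma Q)) * h4 + hσ)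

theorem exists_isWeilRepresentation (hQ : IsNondegenerate Q) :
    ∃ ρ : Representation ℂ Metaplectic (M →₀ ℂ), IsWeilRepresentation Q ρ := by
  set t : (Matrix M M ℂ)ˣ := ⟨weilT Q, Matrix.diagonal (fun x => eChar (-Q x)),
    weilT_mul_inv Q, weilT_inv_mul Q⟩ with ht
  set s : (Matrix M M ℂ)ˣ := Units.ofPowEqOne (weilS Q) 8 (weilS_pow_eight hQ) (by norm_num)
    with hs
  have hst : s * t * s = t⁻¹ * s * t⁻¹ := Units.ext (weilS_mul_weilT_mul_weilS hQ)
  have hc : s * s * t = t * (s * s) := Units.ext (weilS_sq_comm hQ)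
  have hbraid : s ^ 2 = (s * t) ^ 3 := by
    have h1 : (s * t) ^ 3 = (s * t * s) * t * s * t := by
      simp only [pow_succ, pow_zero, one_mul, mul_assoc]
    rw [h1, hst, inv_mul_cancel_right, mul_assoc, mul_assoc, ← mul_assoc s s t, hc,
      inv_mul_cancel_left, sq]
  have h8 : s ^ 8 = 1 := Units.ext (by
    rw [Units.val_pow_eq_pow_val]; exact weilS_pow_eight hQ)
  obtain ⟨φ, hφS, hφT⟩ := Metaplectic.exists_hom hbraid h8
  set b : Module.Basis M ℂ (M →₀ ℂ) := Finsupp.basisSingleOne with hb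
  have happ : ∀ (A : Matrix M M ℂ) (x : M), Matrix.toLinAlgEquiv b A (Finsupp.single x 1) =
      ∑ y, A y x • Finsupp.single y (1 : ℂ) := by
    intro A x
    have h := Matrix.toLinAlgEquiv_self b A x
    simpa only [hb, Finsupp.coe_basisSingleOne] using h
  refine ⟨((Matrix.toLinAlgEquiv b : Matrix M M ℂ →* ((M →₀ ℂ) →ₗ[ℂ] (M →₀ ℂ))).comp
    (Units.coeHom _)).comp φ, ?_, ?_⟩
  · intro x
    change Matrix.toLinAlgEquiv b (φ Metaplectic.T : Matrix M M ℂ) (Finsupp.single x 1) = _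
    rw [hφT, happ]
    change ∑ y, weilT Q y x • Finsupp.single y (1 : ℂ) = _
    rw [Finset.sum_eq_single x]
    · rw [weilT, Matrix.diagonal_apply_eq]
    · intro y _ hy
      rw [weilT, Matrix.diagonal_apply_ne _ hy, zero_smul]
    · simp
  · intro x
    change Matrix.toLinAlgEquiv b (φ Metaplectic.S : Matrix M M ℂ) (Finsupp.single x 1) = _
    rw [hφS, happ, finsum_eq_sum_of_fintype, Finset.smul_sum]
    refine Finset.sum_congr rfl fun y _ => ?_
    rw [smul_smul]
    rfl

/-- A vector of `W(M)` is invariant if and only if it is supported on isotropic vectors and equal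
to its own (normalised) Fourier transform. -/
theorem mem_invariants_iff {ρ : Representation ℂ Metaplectic (M →₀ ℂ)}
    (hρ : IsWeilRepresentation Q ρ) (v : M →₀ ℂ) :
    v ∈ ρ.invariants ↔ (∀ x, v x ≠ 0 → Q x = 0) ∧
      ∀ y, v y = gaussSigma Q * ((Real.sqrt (Nat.card M) : ℝ) : ℂ)⁻¹ *
        ∑ x, v x * eChar (-QuadraticMap.polar Q y x) := by
  have hv : v = ∑ x, v x • Finsupp.single x (1 : ℂ) := by
    conv_lhs => rw [← Finsupp.univ_sum_single v]
    exact Finset.sum_congr rfl fun x _ => by rw [Finsupp.smul_single, smul_eq_mul, mul_one]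
  have hT : ∀ y, ρ Metaplectic.T v y = eChar (Q y) * v y := by
    intro y
    conv_lhs => rw [hv, map_sum]
    simp only [map_smul, hρ.T_apply]
    rw [Finsupp.finsetSum_apply, Finset.sum_eq_single y]
    · simp [mul_comm]
    · intro x _ hx
      simp [hx]
    · simp
  have hS : ∀ y, ρ Metaplectic.S v y = gaussSigma Q * ((Real.sqrt (Nat.card M) : ℝ) : ℂ)⁻¹ *
        ∑ x, v x * eChar (-QuadraticMap.polar Q y x) := by
    intro y
    conv_lhs => rw [hv, map_sum]
    simp only [map_smul, hρ.S_apply, finsum_eq_sum_of_fintype]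
    rw [Finsupp.finsetSum_apply, Finset.mul_sum]
    refine Finset.sum_congr rfl fun x _ => ?_
    rw [Finsupp.smul_apply, Finsupp.smul_apply, Finsupp.finsetSum_apply, Finset.sum_eq_single y]
    · simp; ring
    · intro x _ hx
      simp [hx]
    · simp
  have hgen : v ∈ ρ.invariants ↔ ρ Metaplectic.T v = v ∧ ρ Metaplectic.S v = v := by
    rw [Representation.mem_invariants]
    refine ⟨fun h => ⟨h _, h _⟩, fun ⟨h1, h2⟩ g => ?_⟩
    have hg : g ∈ Subgroup.closure {Metaplectic.S, Metaplectic.T} := by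
      rw [Metaplectic.closure_S_T]; trivial
    induction hg using Subgroup.closure_induction with
    | mem x hx => rcases hx with rfl | rfl <;> assumption
    | one => simp
    | mul x y _ _ hx hy => rw [map_mul, Module.End.mul_apply, hy, hx]
    | inv x _ hx =>
      conv_lhs => rw [← hx]
      rw [← Module.End.mul_apply, ← map_mul, inv_mul_cancel, map_one, Module.End.one_apply]
  rw [hgen]
  refine and_congr ?_ ?_
  · rw [Finsupp.ext_iff]
    refine forall_congr' fun x => ?_
    rw [hT, ← eChar_eq_one_iff]
    refine ⟨fun h hx => mul_right_cancel₀ hx (by rw [h, one_mul]), fun h => ?_⟩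
    by_cases hx : v x = 0
    · rw [hx, mul_zero]
    · rw [h hx, one_mul]
  · rw [Finsupp.ext_iff]
    refine forall_congr' fun y => ?_
    rw [hS, eq_comm]

end WeilRepresentation

/-! ### Finite abelian `p`-groups of rank at most two -/

section PGroup

variable {A : Type*} [AddCommGroup A] {p : ℕ}

/-- Descent along powers of `p`: if multiplication by `p ^ d` already kills everything in `W / U`
that is killed by `p ^ (d + 1)`, then it kills `W / U`. -/
theorem nsmul_mem_of_descent {k d : ℕ} (hk : ∀ x : A, p ^ k • x = 0) {W U : AddSubgroup A}
    (h : ∀ x ∈ W, p ^ (d + 1) • x ∈ U → p ^ d • x ∈ U) : ∀ x ∈ W, p ^ d • x ∈ U := by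
  have h1 : ∀ i : ℕ, ∀ x ∈ W, p ^ (d + i) • x ∈ U → p ^ d • x ∈ U := by
    intro i
    induction i with
    | zero => exact fun x _ hx => hx
    | succ i ih =>
      intro x hx hxU
      refine ih x hx ?_
      have h2 := h (p ^ i • x) (nsmul_mem hx _)
        (by rw [← mul_smul, ← pow_add, show d + 1 + i = d + (i + 1) by ring]; exact hxU)
      rwa [← mul_smul, ← pow_add] at h2
  intro x hx
  refine h1 k x hx ?_
  rw [pow_add, mul_smul, hk, smul_zero]
  exact zero_mem _

theorem eq_zero_of_zsmul_coprime {B : Type*} [AddCommGroup B] {b : B} {m n : ℤ}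
    (h : IsCoprime m n) (hm : m • b = 0) (hn : n • b = 0) : b = 0 := by
  obtain ⟨u, v, huv⟩ := h
  rw [← one_smul ℤ b, ← huv, add_smul, mul_smul, mul_smul, hm, hn, smul_zero, smul_zero, add_zero]

theorem mem_of_zsmul_coprime {U : AddSubgroup A} {b : A} {m n : ℤ}
    (h : IsCoprime m n) (hm : m • b ∈ U) (hn : n • b ∈ U) : b ∈ U := by
  obtain ⟨u, v, huv⟩ := h
  rw [← one_smul ℤ b, ← huv, add_smul, mul_smul, mul_smul]
  exact add_mem (zsmul_mem hm _) (zsmul_mem hn _)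

variable [Finite A]

theorem card_eq_prime_pow (hp : p.Prime) {k : ℕ} (hk : ∀ x : A, p ^ k • x = 0) :
    ∃ j, Nat.card A = p ^ j := by
  refine ⟨_, Nat.eq_prime_pow_of_unique_prime_dvd (p := p) Nat.card_pos.ne' ?_⟩
  intro d hd hdvd
  have := Fact.mk hd
  obtain ⟨x, hx⟩ := exists_prime_addOrderOf_dvd_card' d hdvd
  have h1 : d ∣ p ^ k := hx ▸ addOrderOf_dvd_of_nsmul_eq_zero (hk x)
  exact (Nat.prime_dvd_prime_iff_eq hd hp).mp (hd.dvd_of_dvd_pow h1)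

theorem index_range_nsmul (n : ℕ) :
    (nsmulAddMonoidHom (α := A) n).range.index = Nat.card {x : A // n • x = 0} := by
  have h1 := AddSubgroup.card_mul_index (nsmulAddMonoidHom (α := A) n).range
  have h2 := AddSubgroup.card_mul_index (nsmulAddMonoidHom (α := A) n).ker
  rw [AddSubgroup.index_ker, ← h1, mul_comm] at h2
  exact (Nat.eq_of_mul_eq_mul_left Nat.card_pos h2).symm

/-- If multiplication by `p` maps `W` into `K`, the index of `K` in `W` is bounded by the size of
the `p`-torsion of the ambient group. -/
theorem relIndex_le_of_nsmul_mem {W K : AddSubgroup A} (h : ∀ x ∈ W, p • x ∈ K) {r : ℕ}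
    (hr : Nat.card {x : A // p • x = 0} ≤ r) : K.relIndex W ≤ r := by
  have h1 : (nsmulAddMonoidHom (α := W) p).range ≤ K.addSubgroupOf W := by
    rintro _ ⟨x, rfl⟩
    exact h x x.2
  have h2 : (K.addSubgroupOf W).index ≤ (nsmulAddMonoidHom (α := W) p).range.index :=
    Nat.le_of_dvd (Nat.pos_of_ne_zero AddSubgroup.index_ne_zero_of_finite)
      (AddSubgroup.index_dvd_of_le h1)
  rw [index_range_nsmul] at h2
  refine h2.trans (le_trans ?_ hr)
  refine Nat.card_le_card_of_injective (fun x => ⟨(x : W), ?_⟩) ?_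
  · have := x.2
    simpa using congrArg Subtype.val this
  · intro x y hxy
    simp only [Subtype.mk.injEq] at hxy
    exact Subtype.ext (Subtype.ext hxy)

/-- Unless a subgroup contains the generating set `X`, adjoining some element of `X` to it divides
its index by at least `p`. -/
theorem exists_index_mul_le (hp : p.Prime) {k : ℕ} (hk : ∀ x : A, p ^ k • x = 0) {X : Set A}
    (hX : X.Nonempty) (hgen : AddSubgroup.closure X = ⊤) (H : AddSubgroup A) :
    ∃ x ∈ X, H ⊔ AddSubgroup.zmultiples x = ⊤ ∨
      (H ⊔ AddSubgroup.zmultiples x).index * p ≤ H.index := by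
  by_cases hXH : X ⊆ H
  · obtain ⟨x, hx⟩ := hX
    refine ⟨x, hx, Or.inl ?_⟩
    rw [eq_top_iff, ← hgen]
    exact ((AddSubgroup.closure_le H).mpr hXH).trans le_sup_left
  · obtain ⟨x, hx, hxH⟩ := Set.not_subset.mp hXH
    refine ⟨x, hx, Or.inr ?_⟩
    set K := H ⊔ AddSubgroup.zmultiples x with hK
    have hxK : x ∈ K := AddSubgroup.mem_sup_right (AddSubgroup.mem_zmultiples x)
    have h1 : H.relIndex K * K.index = H.index := AddSubgroup.relIndex_mul_index le_sup_left
    have h2 : H.relIndex K ≠ 1 := fun e => hxH (AddSubgroup.relIndex_eq_one.mp e hxK)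
    obtain ⟨j, hj⟩ := card_eq_prime_pow hp hk
    have h3 : H.relIndex K ∣ p ^ j := by
      rw [← hj, ← H.card_mul_index]
      exact (Dvd.intro _ h1).mul_left _
    obtain ⟨i, -, hi⟩ := (Nat.dvd_prime_pow hp).mp h3
    have h4 : p ≤ H.relIndex K := by
      rw [hi]
      refine Nat.le_self_pow ?_ p
      rintro rfl
      exact h2 (by rw [hi, pow_zero])
    rw [← h1, mul_comm]
    exact Nat.mul_le_mul_right _ h4

/-- A generating set of a finite abelian `p`-group of rank at most two contains two elements that
generate the group. -/
theorem exists_pair_generating (hp : p.Prime) {k : ℕ} (hk : ∀ x : A, p ^ k • x = 0)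
    (hr : Nat.card {x : A // p • x = 0} ≤ p ^ 2) {X : Set A} (hX : X.Nonempty)
    (hgen : AddSubgroup.closure X = ⊤) :
    ∃ x ∈ X, ∃ y ∈ X, AddSubgroup.closure {x, y} = ⊤ := by
  set Φ := (nsmulAddMonoidHom (α := A) p).range with hΦ
  rw [← index_range_nsmul] at hr
  obtain ⟨x, hx, h1⟩ := exists_index_mul_le hp hk hX hgen Φ
  obtain ⟨y, hy, h2⟩ := exists_index_mul_le hp hk hX hgen (Φ ⊔ AddSubgroup.zmultiples x)
  refine ⟨x, hx, y, hy, ?_⟩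
  have h3 : Φ ⊔ AddSubgroup.zmultiples x ⊔ AddSubgroup.zmultiples y = ⊤ := by
    rcases h1 with h1 | h1
    · rw [h1, top_sup_eq]
    · rcases h2 with h2 | h2
      · exact h2
      · rw [← AddSubgroup.index_eq_one]
        have h4 := Nat.mul_le_mul_right p h2
        have h5 : (Φ ⊔ AddSubgroup.zmultiples x ⊔ AddSubgroup.zmultiples y).index * p ^ 2 ≤
            1 * p ^ 2 := by
          rw [one_mul, sq, ← mul_assoc, ← sq]
          exact h4.trans (h1.trans hr)
        have h6 := Nat.le_of_mul_le_mul_right h5 (pow_pos hp.pos 2)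
        have h7 := AddSubgroup.index_ne_zero_of_finite
          (H := Φ ⊔ AddSubgroup.zmultiples x ⊔ AddSubgroup.zmultiples y)
        omega
  -- Nakayama's argument: a subgroup that generates modulo `pA` generates modulo every `p ^ i A`.
  set C := AddSubgroup.closure {x, y} with hC
  have h4 : Φ ⊔ C = ⊤ := by
    rw [eq_top_iff, ← h3, sup_assoc]
    refine sup_le_sup_left (sup_le ?_ ?_) _
    · rw [AddSubgroup.zmultiples_le]; exact AddSubgroup.subset_closure (by simp)
    · rw [AddSubgroup.zmultiples_le]; exact AddSubgroup.subset_closure (by simp)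
  have h5 : ∀ i : ℕ, ∀ a : A, ∃ b : A, ∃ c ∈ C, a = p ^ i • b + c := by
    intro i
    induction i with
    | zero => exact fun a => ⟨a, 0, zero_mem _, by simp⟩
    | succ i ih =>
      intro a
      obtain ⟨b, c, hc, rfl⟩ := ih a
      have hb : b ∈ Φ ⊔ C := by rw [h4]; trivial
      obtain ⟨_, ⟨b', rfl⟩, c', hc', rfl⟩ := AddSubgroup.mem_sup.mp hb
      refine ⟨b', p ^ i • c' + c, add_mem (nsmul_mem hc' _) hc, ?_⟩
      simp only [nsmulAddMonoidHom_apply]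
      rw [smul_add, pow_succ, mul_smul, add_assoc]
  rw [eq_top_iff]
  intro a _
  obtain ⟨b, c, hc, rfl⟩ := h5 k a
  rwa [hk, zero_add]

end PGroup

/-! ### Self-dual isotropic subgroups of `p`-modules -/

section Local

variable {P : Type*} [AddCommGroup P] [Finite P] {Q : QuadraticMap ℤ P (AddCircle (1 : ℚ))}
  {p k : ℕ}

/-- Let `R` be generated by isotropic vectors and suppose that `R^⊥` is isotropic. In rank at most
two, `R` is generated by two of the isotropic vectors, `x` and `y`, and `⟨x⟩ + R^⊥` is self-dual:
an element `ax + by` of `R` that is orthogonal to `x` has `by` orthogonal to both `x` and `y`. -/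
theorem exists_selfDual_of_generated (hQ : IsNondegenerate Q) (hp : p.Prime)
    (hk : ∀ x : P, p ^ k • x = 0) (hr : Nat.card {x : P // p • x = 0} ≤ p ^ 2) {X : Set P}
    (hX : X.Nonempty) (hX0 : ∀ x ∈ X, Q x = 0)
    (hiso : IsIsotropic Q (orth Q (AddSubgroup.closure X))) :
    ∃ V : AddSubgroup P, IsIsotropic Q V ∧ orth Q V = V := by
  set R := AddSubgroup.closure X with hR
  have hpair : ∃ x ∈ X, ∃ y ∈ X, AddSubgroup.closure {x, y} = R := by
    have hgen : AddSubgroup.closure ((↑) ⁻¹' X : Set R) = ⊤ :=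
      AddSubgroup.closure_closure_coe_preimage
    have hne : ((↑) ⁻¹' X : Set R).Nonempty := by
      obtain ⟨x, hx⟩ := hX
      exact ⟨⟨x, AddSubgroup.subset_closure hx⟩, hx⟩
    have hr' : Nat.card {x : R // p • x = 0} ≤ p ^ 2 := by
      refine le_trans (Nat.card_le_card_of_injective
        (fun x => (⟨((x : R) : P), by simpa using congrArg Subtype.val x.2⟩ :
          {x : P // p • x = 0})) ?_) hr
      intro x y hxy
      simp only [Subtype.mk.injEq] at hxy
      exact Subtype.ext (Subtype.ext hxy)
    obtain ⟨x, hx, y, hy, hxy⟩ := exists_pair_generating hp (k := k)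
      (fun x : R => Subtype.ext (by simpa using hk x)) hr' hne hgen
    refine ⟨x, hx, y, hy, ?_⟩
    have := congrArg (AddSubgroup.map R.subtype) hxy
    rw [AddMonoidHom.map_closure, Set.image_pair, ← AddMonoidHom.range_eq_map,
      AddSubgroup.range_subtype] at this
    exact this
  obtain ⟨x, hx, y, hy, hxy⟩ := hpair
  have hxR : x ∈ R := AddSubgroup.subset_closure hx
  have hself : ∀ z ∈ X, QuadraticMap.polar Q z z = 0 := fun z hz => by
    rw [polar_self_eq, hX0 z hz, smul_zero]
  set V := AddSubgroup.zmultiples x ⊔ orth Q R with hV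
  have hxV : x ∈ V := AddSubgroup.mem_sup_left (AddSubgroup.mem_zmultiples x)
  have hVi : IsIsotropic Q V := by
    intro v hv
    obtain ⟨_, ⟨a, rfl⟩, u, hu, rfl⟩ := AddSubgroup.mem_sup.mp hv
    simp only
    rw [form_add, form_zsmul, hX0 x hx, hiso u hu, polar_symm, hu _ (zsmul_mem hxR a)]
    simp
  refine ⟨V, hVi, le_antisymm ?_ hVi.le_orth⟩
  intro z hz
  have hzR : z ∈ R := by
    rw [← orth_orth hQ R]
    exact fun u hu => hz u (AddSubgroup.mem_sup_right hu)
  rw [← hxy, AddSubgroup.mem_closure_pair] at hzR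
  obtain ⟨a, b, rfl⟩ := hzR
  have hax : a • x ∈ V := zsmul_mem hxV a
  refine add_mem hax (AddSubgroup.mem_sup_right ?_)
  have hbx : QuadraticMap.polar Q (b • y) x = 0 := by
    have := hz x hxV
    rwa [QuadraticMap.polar_add_left, polar_zsmul_left, hself x hx, smul_zero, zero_add] at this
  rw [← hxy, mem_orth_closure]
  rintro u (rfl | rfl)
  · exact hbx
  · rw [polar_zsmul_left, hself _ hy, smul_zero]

theorem eChar_injective : Function.Injective eChar := by
  intro a b h
  rw [← sub_eq_zero, ← eChar_eq_one_iff, sub_eq_add_neg, eChar_add, h, ← eChar_add,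
    add_neg_cancel, eChar_zero]

/-- Three complex numbers of absolute value one whose sum is `1` include the number `1`: they are
the roots of `X³ - X² + cX - c` with `c` their product. -/
theorem eq_one_of_sum_eq_one {a b c : ℂ} (ha : ‖a‖ = 1) (hb : ‖b‖ = 1) (hc : ‖c‖ = 1)
    (h : a + b + c = 1) : a = 1 ∨ b = 1 ∨ c = 1 := by
  have key : ∀ {z : ℂ}, ‖z‖ = 1 → z * (starRingEnd ℂ) z = 1 := by
    intro z hz
    rw [Complex.mul_conj, Complex.normSq_eq_norm_sq, hz]
    norm_num
  have h' : (starRingEnd ℂ) a + (starRingEnd ℂ) b + (starRingEnd ℂ) c = 1 := by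
    rw [← map_add, ← map_add, h, map_one]
  have e2 : b * c + a * c + a * b = a * b * c := by
    linear_combination a * b * c * h' - b * c * key ha - a * c * key hb - a * b * key hc
  have h0 : (1 - a) * ((1 - b) * (1 - c)) = 0 := by
    linear_combination e2 - h
  rcases mul_eq_zero.mp h0 with h1 | h1
  · exact Or.inl (sub_eq_zero.mp h1).symm
  · rcases mul_eq_zero.mp h1 with h1 | h1
    · exact Or.inr (Or.inl (sub_eq_zero.mp h1).symm)
    · exact Or.inr (Or.inr (sub_eq_zero.mp h1).symm)

theorem exists_ne_zero_eq_one {N : Type*} [AddCommGroup N] [Fintype N] (hN : Nat.card N = 4)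
    {h : N → ℂ} (hn : ∀ x, ‖h x‖ = 1) (h0 : h 0 = 1) (hs : ∑ x, h x = 2) :
    ∃ x ≠ 0, h x = 1 := by
  have h3 : (Finset.univ.erase (0 : N)).card = 3 := by
    rw [Finset.card_erase_of_mem (Finset.mem_univ _), Finset.card_univ,
      ← Nat.card_eq_fintype_card, hN]
  rw [← Finset.add_sum_erase _ _ (Finset.mem_univ (0 : N)), h0] at hs
  obtain ⟨a, b, c, hab, hac, hbc, habc⟩ := Finset.card_eq_three.mp h3
  have hne : ∀ z ∈ ({a, b, c} : Finset N), z ≠ 0 := by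
    intro z hz
    rw [← habc] at hz
    exact Finset.ne_of_mem_erase hz
  rw [habc, Finset.sum_insert (by simp [hab, hac]), Finset.sum_pair hbc] at hs
  rcases eq_one_of_sum_eq_one (hn a) (hn b) (hn c) (by linear_combination hs) with e | e | e
  · exact ⟨a, hne a (by simp), e⟩
  · exact ⟨b, hne b (by simp), e⟩
  · exact ⟨c, hne c (by simp), e⟩

theorem sum_eq_card_mul_sum_quotient {A : Type*} [AddCommGroup A] [Fintype A] (U : AddSubgroup A)
    (h : A ⧸ U → ℂ) : ∑ x : A, h x = Nat.card U * ∑ n, h n := by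
  rw [← Equiv.sum_comp (AddSubgroup.addGroupEquivQuotientProdAddSubgroup (s := U)).symm,
    Fintype.sum_prod_type, Finset.mul_sum]
  refine Finset.sum_congr rfl fun n _ => ?_
  have h1 : ∀ u : U, ((AddSubgroup.addGroupEquivQuotientProdAddSubgroup (s := U)).symm (n, u) :
      A ⧸ U) = n := by
    intro u
    obtain ⟨x, hx⟩ := (AddSubgroup.addGroupEquivQuotientProdAddSubgroup (s := U)).surjective (n, u)
    rw [← hx, Equiv.symm_apply_apply]
    exact congrArg Prod.fst hx
  simp only [h1]
  rw [Finset.sum_const, Finset.card_univ, ← Nat.card_eq_fintype_card, nsmul_eq_mul]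

end Local

section Local

variable {P : Type*} [AddCommGroup P] {Q : QuadraticMap ℤ P (AddCircle (1 : ℚ))}
  {p k : ℕ}

theorem pow_smul_form_eq_zero (hk : ∀ x : P, p ^ k • x = 0) (x : P) :
    ((p : ℤ) ^ (k + k)) • Q x = 0 := by
  have h := form_zsmul (Q := Q) ((p : ℤ) ^ k) x
  rw [← Nat.cast_pow, natCast_zsmul, hk, QuadraticMap.map_zero, Nat.cast_pow, ← pow_add] at h
  exact h.symm

/-- For odd `p`, divisibility by two can be cancelled in values of `Q`. -/
theorem smul_form_eq_zero_of_two (hp : p.Prime) (hp2 : p ≠ 2) (hk : ∀ x : P, p ^ k • x = 0)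
    {x : P} {a : ℤ} (h : (2 : ℤ) • a • Q x = 0) : a • Q x = 0 := by
  refine eq_zero_of_zsmul_coprime (m := 2) (n := (p : ℤ) ^ (k + k)) ?_ h ?_
  · apply IsCoprime.pow_right
    exact_mod_cast (Nat.coprime_primes Nat.prime_two hp).mpr (Ne.symm hp2)
  · rw [smul_comm, pow_smul_form_eq_zero hk, smul_zero]

theorem polar_eq_zero_of_mem {U : AddSubgroup P} {u x : P} (hu : u ∈ U) (hx : x ∈ orth Q U) :
    QuadraticMap.polar Q u x = 0 := by
  rw [polar_symm]; exact hx u hu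

variable [Finite P]

/-- The index of an isotropic subgroup in its orthogonal complement controls the size of the
module. -/
theorem card_eq_sq_mul_relIndex (hQ : IsNondegenerate Q) {U : AddSubgroup P}
    (hU : IsIsotropic Q U) :
    Nat.card (orth Q U) = Nat.card U * U.relIndex (orth Q U) ∧
      Nat.card P = Nat.card U ^ 2 * U.relIndex (orth Q U) := by
  have h1 : Nat.card (orth Q U) = Nat.card U * U.relIndex (orth Q U) := by
    rw [← AddSubgroup.card_mul_index (U.addSubgroupOf (orth Q U))]
    congr 1
    exact Nat.card_congr (AddSubgroup.addSubgroupOfEquivOfLe hU.le_orth).toEquiv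
  refine ⟨h1, ?_⟩
  rw [← card_mul_card_orth hQ U, h1]
  ring

/-- The case of odd `p`. If `U` is a maximal isotropic subgroup and `U^⊥ / U` is nonzero of square
order, then it is an anisotropic plane over `𝔽_p`. Averaging the Gauss sums of the forms `aQ` over
`a` in `𝔽_p` counts the isotropic vectors; since each of the `p - 1` nontrivial Gauss sums has
absolute value `p|U|`, each of them must equal `-p|U|`, contrary to `σ(P) = 1`. -/
theorem relIndex_eq_one_of_odd (hQ : IsNondegenerate Q) (hp : p.Prime) (hp2 : p ≠ 2)
    (hk : ∀ x : P, p ^ k • x = 0) (hr : Nat.card {x : P // p • x = 0} ≤ p ^ 2)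
    (hσ : gaussSigma Q = 1) {U : AddSubgroup P} (hU : IsIsotropic Q U)
    (hmax : ∀ x ∈ orth Q U, Q x = 0 → x ∈ U) {i : ℕ}
    (hi : U.relIndex (orth Q U) = (p ^ i) ^ 2) : U.relIndex (orth Q U) = 1 := by
  by_contra hne
  have hpW : ∀ x ∈ orth Q U, p • x ∈ U := by
    have := nsmul_mem_of_descent (d := 1) (p := p) (W := orth Q U) (U := U) hk ?_
    · simpa using this
    · intro x hx hxU
      rw [pow_one]
      refine hmax _ (nsmul_mem hx _) ?_
      rw [← natCast_zsmul, form_zsmul]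
      refine smul_form_eq_zero_of_two hp hp2 hk ?_
      have h1 := polar_eq_zero_of_mem hxU hx
      rw [← natCast_zsmul, polar_zsmul_left, polar_self_eq, smul_comm] at h1
      rw [← h1]
      push_cast
      rw [sq]
  have hpQ : ∀ x ∈ orth Q U, (p : ℤ) • Q x = 0 := by
    intro x hx
    refine smul_form_eq_zero_of_two hp hp2 hk ?_
    have h1 := polar_eq_zero_of_mem (hpW x hx) hx
    rwa [← natCast_zsmul, polar_zsmul_left, polar_self_eq, smul_comm] at h1
  have hind : U.relIndex (orth Q U) = p ^ 2 := by
    refine le_antisymm (relIndex_le_of_nsmul_mem hpW hr) ?_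
    rw [hi] at hne ⊢
    refine Nat.pow_le_pow_left (Nat.le_self_pow ?_ p) 2
    rintro rfl
    simp at hne
  obtain ⟨hW, hP⟩ := card_eq_sq_mul_relIndex hQ hU
  rw [hind] at hW hP
  set W := orth Q U with hWdef
  set u : ℕ := Nat.card U with hu
  have hu0 : 0 < u := Nat.card_pos
  set G : ℕ → ℂ := fun a => ∑ x : W, eChar (-((a : ℤ) • Q x)) with hG
  have hG0 : G 0 = (p : ℂ) ^ 2 * u := by
    simp only [hG, Nat.cast_zero, zero_smul, neg_zero, eChar_zero]
    rw [Finset.sum_const, Finset.card_univ, ← Nat.card_eq_fintype_card, hW]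
    simp [mul_comm]
  have hG1 : G 1 = (p : ℂ) * u := by
    have h1 := sum_eChar_neg_eq Q
    rw [hσ, mul_one, sum_eq_sum_orth hU, hP, ← mul_pow, Nat.cast_pow,
      Real.sqrt_sq (Nat.cast_nonneg _)] at h1
    simp only [hG, Nat.cast_one, one_smul]
    rw [h1]
    push_cast
    ring
  have hGn : ∀ a ∈ Finset.Ico 2 p, ‖G a‖ ≤ p * u := by
    intro a ha
    rw [Finset.mem_Ico] at ha
    have hcop : IsCoprime (a : ℤ) ((p : ℤ) ^ k) := by
      apply IsCoprime.pow_right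
      rw [Nat.isCoprime_iff_coprime]
      exact ((Nat.Prime.coprime_iff_not_dvd hp).mpr
        (Nat.not_dvd_of_pos_of_lt (by omega) ha.2)).symm
    have hrad : Nat.card {z : W // ∀ y, QuadraticMap.polar
        (((a : ℤ) • Q).comp W.subtype.toIntLinearMap) z y = 0} ≤ u := by
      have hmem : ∀ z : W, (∀ y, QuadraticMap.polar
          (((a : ℤ) • Q).comp W.subtype.toIntLinearMap) z y = 0) → (z : P) ∈ U := by
        intro z hz
        have hz2 : (a : ℤ) • (z : P) ∈ U := by
          rw [← orth_orth hQ U]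
          intro y hy
          have := hz ⟨y, hy⟩
          rw [polar_zsmul_left]
          rw [← this]
          simp [QuadraticMap.polar, smul_sub]
        refine mem_of_zsmul_coprime hcop hz2 ?_
        rw [← Nat.cast_pow, natCast_zsmul, hk]
        exact zero_mem _
      refine Nat.card_le_card_of_injective (fun z => ⟨((z : W) : P), hmem z z.2⟩) ?_
      intro z z' h
      simp only [Subtype.mk.injEq] at h
      exact Subtype.ext (Subtype.ext h)
    have h1 := gauss_norm_sq_le (((a : ℤ) • Q).comp W.subtype.toIntLinearMap) hrad
    have h2 : ∑ x : W, eChar (-(((a : ℤ) • Q).comp W.subtype.toIntLinearMap) x) = G a := rfl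
    rw [h2, hW] at h1
    refine (sq_le_sq₀ (norm_nonneg _) (by positivity)).mp ?_
    refine h1.trans (le_of_eq ?_)
    push_cast
    ring
  have hsum : ∑ a ∈ Finset.range p, G a = (p : ℂ) * u := by
    simp only [hG]
    rw [Finset.sum_comm]
    have h1 : ∀ x : W, ∑ a ∈ Finset.range p, eChar (-((a : ℤ) • Q x)) =
        if (x : P) ∈ U then (p : ℂ) else 0 := by
      intro x
      have h2 : ∀ a : ℕ, eChar (-((a : ℤ) • Q x)) = eChar (-Q x) ^ a := by
        intro a
        induction a with
        | zero => simp [eChar_zero]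
        | succ a ih =>
          rw [Nat.cast_succ, add_smul, neg_add, eChar_add, ih, one_smul, pow_succ]
      split_ifs with hx
      · simp [hU x hx, eChar_zero]
      · simp only [h2]
        have h3 : eChar (-Q x) ≠ 1 := by
          rw [Ne, eChar_eq_one_iff, neg_eq_zero]
          exact fun h => hx (hmax x x.2 h)
        have h4 : eChar (-Q x) ^ p = 1 := by
          rw [← h2, hpQ x x.2, neg_zero, eChar_zero]
        have h5 := mul_geom_sum (eChar (-Q x)) p
        rw [h4, sub_self] at h5
        exact (mul_eq_zero.mp h5).resolve_left (sub_ne_zero.mpr h3)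
    simp only [h1]
    rw [← Finset.sum_filter, Finset.sum_const, nsmul_eq_mul, ← Fintype.card_subtype,
      ← Nat.card_eq_fintype_card, mul_comm]
    congr 2
    exact Nat.card_congr (AddSubgroup.addSubgroupOfEquivOfLe hU.le_orth).toEquiv
  have hp3 : 2 ≤ p := hp.two_le
  have hsplit : ∑ a ∈ Finset.range p, G a = G 0 + G 1 + ∑ a ∈ Finset.Ico 2 p, G a := by
    rw [Finset.range_eq_Ico, ← Finset.sum_Ico_consecutive G (Nat.zero_le 2) hp3]
    congr 1
    rw [← Finset.range_eq_Ico, Finset.sum_range_succ, Finset.sum_range_one]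
  have hrest : ∑ a ∈ Finset.Ico 2 p, G a = -((p : ℂ) ^ 2 * u) := by
    rw [hsum, hG0, hG1] at hsplit
    linear_combination -hsplit
  have hn := norm_sum_le (Finset.Ico 2 p) G
  rw [hrest, norm_neg] at hn
  have hn2 := hn.trans (Finset.sum_le_sum hGn)
  rw [Finset.sum_const, Nat.card_Ico, nsmul_eq_mul, Nat.cast_sub hp3] at hn2
  simp only [norm_mul, norm_pow, Complex.norm_natCast, Nat.cast_ofNat] at hn2
  have hpu : (0 : ℝ) < p * u := by
    have := hp.pos
    positivity
  nlinarith

/-- The case `p = 2`. If `U` is a maximal isotropic subgroup and `U^⊥ / U` is nonzero of square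
order, then it has order four, and `σ(P) = 1` means that the values of `e(-Q)` on its three nonzero
elements sum to one; this forces a nonzero isotropic element. -/
theorem relIndex_eq_one_of_two (hQ : IsNondegenerate Q) (hk : ∀ x : P, 2 ^ k • x = 0)
    (hr : Nat.card {x : P // 2 • x = 0} ≤ 2 ^ 2)
    (hσ : gaussSigma Q = 1) {U : AddSubgroup P} (hU : IsIsotropic Q U)
    (hmax : ∀ x ∈ orth Q U, Q x = 0 → x ∈ U) {i : ℕ}
    (hi : U.relIndex (orth Q U) = (2 ^ i) ^ 2) : U.relIndex (orth Q U) = 1 := by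
  by_contra hne
  have h4W : ∀ x ∈ orth Q U, 4 • x ∈ U := by
    have := nsmul_mem_of_descent (d := 2) (p := 2) (W := orth Q U) (U := U) hk ?_
    · simpa using this
    · intro x hx hxU
      refine hmax _ (nsmul_mem hx _) ?_
      have h1 := polar_eq_zero_of_mem hxU hx
      rw [← natCast_zsmul, polar_zsmul_left, polar_self_eq, ← mul_smul] at h1
      rw [← natCast_zsmul, form_zsmul, ← h1]
      norm_num
  have h8Q : ∀ x ∈ orth Q U, (8 : ℤ) • Q x = 0 := by
    intro x hx
    have h1 := polar_eq_zero_of_mem (h4W x hx) hx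
    rw [← natCast_zsmul, polar_zsmul_left, polar_self_eq, ← mul_smul] at h1
    exact h1
  set W := orth Q U with hWdef
  -- `x ↦ Q(2x)` is a homomorphism on `U^⊥` with at most two values.
  set φ : W →+ AddCircle (1 : ℚ) :=
    { toFun := fun x => (4 : ℤ) • Q x
      map_zero' := by simp
      map_add' := fun x y => by
        have h1 := polar_eq_zero_of_mem (h4W x x.2) y.2
        rw [← natCast_zsmul, polar_zsmul_left] at h1
        rw [AddSubgroup.coe_add, form_add, smul_add, smul_add]
        rw [show ((4 : ℕ) : ℤ) = 4 by rfl] at h1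
        rw [h1, add_zero] } with hφ
  have hφr : Nat.card φ.range ≤ 2 := by
    have h1 : (eChar '' (φ.range : Set (AddCircle (1 : ℚ)))) ⊆ {1, -1} := by
      rintro _ ⟨_, ⟨x, rfl⟩, rfl⟩
      have h2 : eChar (φ x) * eChar (φ x) = 1 := by
        rw [← eChar_add, ← two_zsmul]
        have h3 : (2 : ℤ) • φ x = (8 : ℤ) • Q x := by
          change (2 : ℤ) • (4 : ℤ) • Q x = _
          rw [← mul_smul]; norm_num
        rw [h3, h8Q x x.2, eChar_zero]
      simpa using mul_self_eq_one_iff.mp h2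
    have h2 := Set.ncard_le_ncard h1 (by simp)
    rw [Set.ncard_image_of_injective _ eChar_injective] at h2
    exact h2.trans (Set.ncard_insert_le _ _ |>.trans (by simp))
  have hindex : U.relIndex W ≤ 8 := by
    set K : AddSubgroup P := φ.ker.map W.subtype with hK
    have hKW : K ≤ W := by
      rintro _ ⟨x, -, rfl⟩
      exact x.2
    have h2K : ∀ x ∈ K, 2 • x ∈ U := by
      rintro _ ⟨x, hx, rfl⟩
      refine hmax _ (nsmul_mem x.2 _) ?_
      rw [← natCast_zsmul, form_zsmul]
      exact hx
    have hUK : U ≤ K := by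
      intro x hx
      refine ⟨⟨x, hU.le_orth hx⟩, ?_, rfl⟩
      change (4 : ℤ) • Q x = 0
      rw [hU x hx, smul_zero]
    have h1 : U.relIndex K ≤ 2 ^ 2 := relIndex_le_of_nsmul_mem h2K hr
    have h2 : K.relIndex W ≤ 2 := by
      have : K.addSubgroupOf W = φ.ker := by
        rw [hK]
        ext x
        simp [AddSubgroup.mem_addSubgroupOf]
      rw [AddSubgroup.relIndex, this, AddSubgroup.index_ker]
      exact hφr
    rw [← AddSubgroup.relIndex_mul_relIndex U K W hUK hKW]
    exact Nat.mul_le_mul h1 h2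
  have hind : U.relIndex W = 4 := by
    rw [hi] at hindex hne ⊢
    have h1 : i < 2 := by
      by_contra h
      have h3 : 2 ^ 2 ≤ 2 ^ i := Nat.pow_le_pow_right (by norm_num) (by omega)
      nlinarith
    interval_cases i
    · simp at hne
    · norm_num
  obtain ⟨hW, hP⟩ := card_eq_sq_mul_relIndex hQ hU
  rw [hind] at hP
  have hu0 : (Nat.card U : ℂ) ≠ 0 := Nat.cast_ne_zero.mpr Nat.card_pos.ne'
  have hG1 : ∑ x : W, eChar (-Q x) = Nat.card U * 2 := by
    have h1 := sum_eChar_neg_eq Q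
    rw [hσ, mul_one, sum_eq_sum_orth hU, hP, show Nat.card U ^ 2 * 4 = (Nat.card U * 2) ^ 2 by ring,
      Nat.cast_pow, Real.sqrt_sq (Nat.cast_nonneg _)] at h1
    rw [h1]
    push_cast
    ring
  set h : W ⧸ U.addSubgroupOf W → ℂ := Quotient.lift (fun x : W => eChar (-Q x)) (by
    intro x y hxy
    have hz : -x + y ∈ U.addSubgroupOf W := QuotientAddGroup.leftRel_apply.mp hxy
    have hz' : -(x : P) + y ∈ U := hz
    have e : (y : P) = (-(x : P) + y) + x := by abel
    change eChar (-Q x) = eChar (-Q y)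
    rw [e, form_add, hU _ hz', polar_eq_zero_of_mem hz' x.2]
    simp) with hh
  have hmk : ∀ x : W, h x = eChar (-Q x) := fun x => rfl
  have hs := sum_eq_card_mul_sum_quotient (U.addSubgroupOf W) h
  simp only [hmk] at hs
  rw [hG1, Nat.card_congr (AddSubgroup.addSubgroupOfEquivOfLe hU.le_orth).toEquiv] at hs
  obtain ⟨n, hn0, hn1⟩ := exists_ne_zero_eq_one (N := W ⧸ U.addSubgroupOf W) hind (h := h)
    (fun n => by
      induction n using QuotientAddGroup.induction_on with
      | H x => rw [hmk, norm_eChar])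
    (by
      rw [← QuotientAddGroup.mk_zero, hmk]
      simp [eChar_zero])
    (mul_left_cancel₀ hu0 hs).symm
  induction n using QuotientAddGroup.induction_on with
  | H x =>
    rw [hmk, eChar_eq_one_iff, neg_eq_zero] at hn1
    exact hn0 ((QuotientAddGroup.eq_zero_iff _).mpr (hmax x x.2 hn1))

theorem isSquare_of_mul_coprime {a b : ℕ} (hab : a.Coprime b) (h : IsSquare (a * b)) :
    IsSquare a := by
  obtain ⟨c, hc⟩ := h
  obtain ⟨d, hd⟩ := exists_eq_pow_of_mul_eq_pow (k := 2) (a := a) (b := b) (c := c)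
    (Nat.isUnit_iff.mpr hab) (by rw [hc, sq])
  exact ⟨d, by rw [hd, sq]⟩

/-- In a `p`-module of rank at most two, of square order and with `σ = 1`, every maximal isotropic
subgroup is self-dual. -/
theorem orth_eq_of_maximal (hQ : IsNondegenerate Q) (hp : p.Prime)
    (hk : ∀ x : P, p ^ k • x = 0) (hr : Nat.card {x : P // p • x = 0} ≤ p ^ 2)
    (hsq : IsSquare (Nat.card P)) (hσ : gaussSigma Q = 1) {U : AddSubgroup P}
    (hU : IsIsotropic Q U) (hmax : ∀ x ∈ orth Q U, Q x = 0 → x ∈ U) : orth Q U = U := by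
  obtain ⟨-, hP⟩ := card_eq_sq_mul_relIndex hQ hU
  obtain ⟨j, hj⟩ := card_eq_prime_pow hp hk
  obtain ⟨c, hc⟩ := hsq
  have hu : 0 < Nat.card U := Nat.card_pos
  have hdvd : Nat.card U ∣ c := by
    rw [← Nat.pow_dvd_pow_iff (n := 2) (by norm_num)]
    exact ⟨_, by rw [← hP, hc, sq]⟩
  obtain ⟨d, rfl⟩ := hdvd
  have hd : U.relIndex (orth Q U) = d ^ 2 := by
    have h1 : Nat.card U ^ 2 * U.relIndex (orth Q U) = Nat.card U ^ 2 * d ^ 2 := by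
      rw [← hP, hc]; ring
    exact Nat.eq_of_mul_eq_mul_left (by positivity) h1
  have hd2 : d ∣ p ^ j := ⟨Nat.card U * (Nat.card U * d), by rw [← hj, hc]; ring⟩
  obtain ⟨i, -, rfl⟩ := (Nat.dvd_prime_pow hp).mp hd2
  refine le_antisymm (AddSubgroup.relIndex_eq_one.mp ?_) hU.le_orth
  by_cases hp2 : p = 2
  · subst hp2
    exact relIndex_eq_one_of_two hQ hk hr hσ hU hmax hd
  · exact relIndex_eq_one_of_odd hQ hp hp2 hk hr hσ hU hmax hd

end Local

/-! ### Invariants and primary components -/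

section Global

variable {M : Type*} [AddCommGroup M]

variable {Q : QuadraticMap ℤ M (AddCircle (1 : ℚ))}

theorem primaryForm_apply (p : ℕ) (x : AddCommGroup.primaryComponent M p) :
    primaryForm Q p x = Q x := rfl

theorem zsmul_eq_self_of_projector {p k : ℕ} {e c : ℤ} (he : e = 1 + (p : ℤ) ^ k * c)
    (hkill : ∀ x : AddCommGroup.primaryComponent M p, p ^ k • x = 0)
    (z : AddCommGroup.primaryComponent M p) : e • (z : M) = z := by
  have h : ((p : ℤ) ^ k) • (z : M) = 0 := by
    rw [← Nat.cast_pow, natCast_zsmul]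
    exact congrArg Subtype.val (hkill z)
  rw [he, add_smul, one_smul, mul_comm, mul_smul, h, smul_zero, add_zero]

/-- Pairing with an element of the `p`-part only sees the projection to the `p`-part. -/
theorem polar_zsmul_projector {p k : ℕ} {e c : ℤ} (he : e = 1 + (p : ℤ) ^ k * c)
    (hkill : ∀ x : AddCommGroup.primaryComponent M p, p ^ k • x = 0)
    (z : AddCommGroup.primaryComponent M p) (y : M) :
    QuadraticMap.polar Q (z : M) (e • y) = QuadraticMap.polar Q (z : M) y := by
  rw [polar_zsmul_right, ← polar_zsmul_left, zsmul_eq_self_of_projector he hkill]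

variable [Finite M]

/-- Multiplication by a suitable integer `e`, congruent to `1` modulo a large power of `p`, is the
projection of `M` onto its `p`-part. -/
theorem exists_primary_projector (M : Type*) [AddCommGroup M] [Finite M] {p : ℕ} (hp : p.Prime) :
    ∃ k : ℕ, ∃ e c : ℤ, 1 ≤ k ∧ e = 1 + (p : ℤ) ^ k * c ∧
      (∀ x : M, e • x ∈ AddCommGroup.primaryComponent M p) ∧
      ∀ x : AddCommGroup.primaryComponent M p, p ^ k • x = 0 := by
  obtain ⟨v, m, hm, hN⟩ := Nat.exists_eq_pow_mul_and_not_dvd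
    (Nat.card_pos (α := M)).ne' p hp.ne_one
  have hcop : IsCoprime ((p : ℤ) ^ (v + 1)) (m : ℤ) := by
    apply IsCoprime.pow_left
    rw [Nat.isCoprime_iff_coprime]
    exact (Nat.Prime.coprime_iff_not_dvd hp).mpr hm
  obtain ⟨a, b, hab⟩ := hcop
  have hkill : ∀ x : M, ((p : ℤ) ^ v * m) • x = 0 := by
    intro x
    have h : Nat.card M • x = 0 := card_nsmul_eq_zero'
    rw [hN, ← natCast_zsmul] at h
    exact_mod_cast h
  refine ⟨v + 1, b * m, -a, by omega, by linear_combination hab, ?_, ?_⟩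
  · intro x
    refine ⟨v, ?_⟩
    rw [← natCast_zsmul, ← mul_smul, Nat.cast_pow,
      show (p : ℤ) ^ v * (b * m) = b * ((p : ℤ) ^ v * m) by ring, mul_smul, hkill, smul_zero]
  · rintro ⟨x, j, hj⟩
    refine Subtype.ext ?_
    change p ^ (v + 1) • x = 0
    have h1 : ((p : ℤ) ^ v) • x = 0 := by
      refine eq_zero_of_zsmul_coprime (m := (p : ℤ) ^ j) (n := m) ?_ ?_ ?_
      · apply IsCoprime.pow_left
        rw [Nat.isCoprime_iff_coprime]
        exact (Nat.Prime.coprime_iff_not_dvd hp).mpr hm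
      · rw [smul_comm, ← Nat.cast_pow p j, natCast_zsmul, hj, smul_zero]
      · rw [← mul_smul, mul_comm, hkill]
    rw [pow_succ', mul_smul, ← natCast_zsmul x, Nat.cast_pow, h1, smul_zero]

theorem card_primary_torsion_le {p r : ℕ} (hr : Nat.card {x : M // p • x = 0} ≤ r) :
    Nat.card {x : AddCommGroup.primaryComponent M p // p • x = 0} ≤ r := by
  refine le_trans (Nat.card_le_card_of_injective
    (fun x => (⟨((x : AddCommGroup.primaryComponent M p) : M),
      by simpa using congrArg Subtype.val x.2⟩ : {x : M // p • x = 0})) ?_) hr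
  intro x y hxy
  simp only [Subtype.mk.injEq] at hxy
  exact Subtype.ext (Subtype.ext hxy)

/-- The order of the `p`-part of `M` is prime to its index, so it is a square if `|M|` is. -/
theorem isSquare_card_primaryComponent {p : ℕ} (hp : p.Prime) (h : IsSquare (Nat.card M)) :
    IsSquare (Nat.card (AddCommGroup.primaryComponent M p)) := by
  obtain ⟨k, e, c, hk1, he, hproj, hkill⟩ := exists_primary_projector M hp
  obtain ⟨j, hj⟩ := card_eq_prime_pow hp hkill
  rw [← AddSubgroup.card_mul_index (AddCommGroup.primaryComponent M p)] at h
  refine isSquare_of_mul_coprime ?_ h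
  rw [hj]
  apply Nat.Coprime.pow_left
  rw [Nat.Prime.coprime_iff_not_dvd hp, AddSubgroup.index]
  intro hdvd
  have := Fact.mk hp
  obtain ⟨y, hy⟩ := exists_prime_addOrderOf_dvd_card' p hdvd
  induction y using QuotientAddGroup.induction_on with
  | H y =>
    -- `e` kills the quotient and is congruent to `1` modulo `p`
    have h1 : p • (y : M ⧸ AddCommGroup.primaryComponent M p) = 0 :=
      addOrderOf_dvd_iff_nsmul_eq_zero.mp (dvd_of_eq hy)
    have h2 : e • (y : M ⧸ AddCommGroup.primaryComponent M p) = 0 := by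
      rw [← QuotientAddGroup.mk_zsmul, QuotientAddGroup.eq_zero_iff]
      exact hproj y
    have h3 : (y : M ⧸ AddCommGroup.primaryComponent M p) = 0 := by
      refine eq_zero_of_zsmul_coprime (m := p) (n := e) ?_ (by rwa [natCast_zsmul]) h2
      obtain ⟨k', rfl⟩ := Nat.exists_eq_add_of_le' hk1
      exact ⟨-((p : ℤ) ^ k' * c), 1, by rw [he]; ring⟩
    rw [h3, addOrderOf_zero] at hy
    exact hp.one_lt.ne hy

theorem IsNondegenerate.primaryForm (hQ : IsNondegenerate Q) {p : ℕ} (hp : p.Prime) :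
    IsNondegenerate (primaryForm Q p) := by
  obtain ⟨k, e, c, -, he, hproj, hkill⟩ := exists_primary_projector M hp
  intro z hz
  refine Subtype.ext (hQ z fun y => ?_)
  rw [← polar_zsmul_projector he hkill]
  exact hz ⟨e • y, hproj y⟩

/-- The support of a nonzero invariant `f` generates a subgroup `R` with `R^⊥` isotropic: as `f`
is supported on `R`, its Fourier transform, which is `f`, is invariant under `R^⊥`. This remains
true in the `p`-part, where the rank hypothesis produces a self-dual isotropic subgroup. -/
theorem exists_selfDual_primary (hQ : IsNondegenerate Q) {p : ℕ} (hp : p.Prime)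
    (hr : Nat.card {x : M // p • x = 0} ≤ p ^ 2) {f : M → ℂ} (hf : ∃ x, f x ≠ 0)
    (hf0 : ∀ x, f x ≠ 0 → Q x = 0) {γ : ℂ}
    (hfS : ∀ y, f y = γ * ∑ x, f x * eChar (-QuadraticMap.polar Q y x)) :
    ∃ V : AddSubgroup (AddCommGroup.primaryComponent M p),
      IsIsotropic (primaryForm Q p) V ∧ orth (primaryForm Q p) V = V := by
  obtain ⟨k, e, c, -, he, hproj, hkill⟩ := exists_primary_projector M hp
  obtain ⟨x₀, hx₀⟩ := hf
  set X : Set (AddCommGroup.primaryComponent M p) := {z | ∃ x, f x ≠ 0 ∧ (z : M) = e • x} with hX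
  refine exists_selfDual_of_generated (X := X) (hQ.primaryForm hp) hp hkill
    (card_primary_torsion_le hr) ⟨⟨e • x₀, hproj x₀⟩, x₀, hx₀, rfl⟩ ?_ ?_
  · rintro z ⟨x, hx, hz⟩
    rw [primaryForm_apply, hz, form_zsmul, hf0 x hx, smul_zero]
  · intro z hz
    rw [mem_orth_closure] at hz
    have hzx : ∀ x, f x ≠ 0 → QuadraticMap.polar Q (z : M) x = 0 := by
      intro x hx
      rw [← polar_zsmul_projector he hkill]
      exact hz ⟨e • x, hproj x⟩ ⟨x, hx, rfl⟩
    have hinv : f (x₀ + z) = f x₀ := by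
      rw [hfS (x₀ + z), hfS x₀]
      congr 1
      refine Finset.sum_congr rfl fun x _ => ?_
      by_cases hx : f x = 0
      · rw [hx, zero_mul, zero_mul]
      · rw [QuadraticMap.polar_add_left, hzx x hx, add_zero]
    have h1 := hf0 (x₀ + z) (by rwa [hinv])
    rw [form_add, hf0 x₀ hx₀, polar_symm, hzx x₀ hx₀, zero_add, add_zero] at h1
    exact h1

/-- If every `p`-part has square order and `σ_p = 1`, every maximal isotropic subgroup is
self-dual. -/
theorem exists_selfDual (hQ : IsNondegenerate Q)
    (hr : ∀ p : ℕ, p.Prime → Nat.card {x : M // p • x = 0} ≤ p ^ 2)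
    (hsq : ∀ p : ℕ, p.Prime → IsSquare (Nat.card (AddCommGroup.primaryComponent M p)))
    (hσ : ∀ p : ℕ, p.Prime → sigmaPrime Q p = 1) :
    ∃ U : AddSubgroup M, IsIsotropic Q U ∧ orth Q U = U := by
  obtain ⟨U, hU, hUmax⟩ : ∃ U : AddSubgroup M, IsIsotropic Q U ∧
      ∀ V : AddSubgroup M, IsIsotropic Q V → U ≤ V → V ≤ U := by
    obtain ⟨U, hU⟩ := (Set.toFinite {U : AddSubgroup M | IsIsotropic Q U}).exists_maximal
      ⟨⊥, by intro u hu; rw [AddSubgroup.mem_bot.mp hu, QuadraticMap.map_zero]⟩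
    exact ⟨U, hU.prop, fun V hV h => hU.le_of_ge hV h⟩
  have hmax : ∀ x ∈ orth Q U, Q x = 0 → x ∈ U := by
    intro x hx hx0
    have h1 : IsIsotropic Q (U ⊔ AddSubgroup.zmultiples x) := by
      intro v hv
      obtain ⟨u, hu, _, ⟨a, rfl⟩, rfl⟩ := AddSubgroup.mem_sup.mp hv
      simp only
      rw [form_add, form_zsmul, hx0, hU u hu, polar_zsmul_right, polar_symm, hx u hu]
      simp
    exact hUmax _ h1 le_sup_left (AddSubgroup.mem_sup_right (AddSubgroup.mem_zmultiples x))
  refine ⟨U, hU, le_antisymm ?_ hU.le_orth⟩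
  have hlocal : ∀ p : ℕ, p.Prime → ∀ z : AddCommGroup.primaryComponent M p,
      (z : M) ∈ orth Q U → (z : M) ∈ U := by
    intro p hp z hz
    obtain ⟨k, e, c, -, he, hproj, hkill⟩ := exists_primary_projector M hp
    set V := U.comap (AddCommGroup.primaryComponent M p).subtype with hV
    have horth : ∀ w : AddCommGroup.primaryComponent M p,
        w ∈ orth (primaryForm Q p) V → (w : M) ∈ orth Q U := by
      intro w hw u hu
      rw [← polar_zsmul_projector he hkill]
      exact hw ⟨e • u, hproj u⟩ (show e • u ∈ U from zsmul_mem hu e)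
    have h1 : orth (primaryForm Q p) V = V :=
      orth_eq_of_maximal (hQ.primaryForm hp) hp hkill (card_primary_torsion_le (hr p hp))
        (hsq p hp) (hσ p hp) (fun u hu => hU u hu) (fun w hw hw0 => hmax w (horth w hw) hw0)
    have h2 : z ∈ orth (primaryForm Q p) V := fun w hw => hz w hw
    rw [h1] at h2
    exact h2
  intro x hx
  -- The order of `x` modulo `U` has no prime divisor.
  have h1 : addOrderOf (x : M ⧸ U) = 1 := by
    by_contra hne
    obtain ⟨p, hp, d, hd⟩ := Nat.exists_prime_and_dvd hne
    obtain ⟨k, e, c, hk1, he, hproj, -⟩ := exists_primary_projector M hp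
    have hpy : p • (d • x) ∈ U := by
      rw [← QuotientAddGroup.eq_zero_iff, ← mul_smul, ← hd, QuotientAddGroup.mk_nsmul]
      exact addOrderOf_nsmul_eq_zero _
    have hey : e • (d • x) ∈ U :=
      hlocal p hp ⟨e • (d • x), hproj _⟩ (zsmul_mem (nsmul_mem hx d) e)
    have hy : d • x ∈ U := by
      refine mem_of_zsmul_coprime (m := p) (n := e) ?_ (by rwa [natCast_zsmul]) hey
      obtain ⟨k', rfl⟩ := Nat.exists_eq_add_of_le' hk1
      exact ⟨-((p : ℤ) ^ k' * c), 1, by rw [he]; ring⟩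
    rw [← QuotientAddGroup.eq_zero_iff, QuotientAddGroup.mk_nsmul,
      ← addOrderOf_dvd_iff_nsmul_eq_zero, hd] at hy
    have hpos : 0 < addOrderOf (x : M ⧸ U) := addOrderOf_pos _
    have hd0 : 0 < d := by
      rw [hd] at hpos
      exact Nat.pos_of_mul_pos_left hpos
    have h3 := Nat.le_of_dvd hd0 hy
    have h4 := hp.two_le
    nlinarith
  rw [AddMonoid.addOrderOf_eq_one_iff, QuotientAddGroup.eq_zero_iff] at h1
  exact h1

/-- The characteristic function of a self-dual isotropic subgroup is invariant. -/
theorem invariants_ne_bot_of_selfDual (hQ : IsNondegenerate Q)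
    {ρ : Representation ℂ Metaplectic (M →₀ ℂ)} (hρ : IsWeilRepresentation Q ρ)
    {U : AddSubgroup M} (hU : IsIsotropic Q U) (hU' : orth Q U = U) : ρ.invariants ≠ ⊥ := by
  set v : M →₀ ℂ := Finsupp.equivFunOnFinite.symm (fun x => if x ∈ U then 1 else 0) with hv
  have hvx : ∀ x, v x = if x ∈ U then 1 else 0 := fun x => rfl
  have hmem : v ∈ ρ.invariants := by
    rw [mem_invariants_iff hρ]
    refine ⟨fun x hx => ?_, fun y => ?_⟩
    · rw [hvx] at hx
      exact hU x (by by_contra h; simp [h] at hx)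
    · have h1 : ∑ x, v x * eChar (-QuadraticMap.polar Q y x) =
          ∑ u : U, eChar (QuadraticMap.polar Q (-y) u) := by
        simp only [hvx, ite_mul, one_mul, zero_mul, QuadraticMap.polar_neg_left]
        rw [← Finset.sum_filter]
        exact Finset.sum_subtype _ (by simp) _
      have h0 : (Nat.card U : ℂ) ≠ 0 := Nat.cast_ne_zero.mpr Nat.card_pos.ne'
      rw [h1, sum_eChar_polar_subgroup, gaussSigma_eq_one hQ hU hU', one_mul, hU', neg_mem_iff,
        hvx, card_eq_sq_of_orth_eq hQ hU', Nat.cast_pow, Real.sqrt_sq (Nat.cast_nonneg _),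
        Complex.ofReal_natCast]
      split_ifs
      · rw [inv_mul_cancel₀ h0]
      · rw [mul_zero]
  intro hbot
  rw [hbot, Submodule.mem_bot] at hmem
  have := hvx 0
  rw [hmem] at this
  simp at this

/-- The criterion for the existence of invariants, for a finite quadratic module whose `p`-parts
have rank at most two. -/
theorem invariants_ne_bot_iff (hQ : IsNondegenerate Q)
    (hr : ∀ p : ℕ, p.Prime → Nat.card {x : M // p • x = 0} ≤ p ^ 2)
    {ρ : Representation ℂ Metaplectic (M →₀ ℂ)} (hρ : IsWeilRepresentation Q ρ) :
    ρ.invariants ≠ ⊥ ↔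
      IsSquare (Nat.card M) ∧ ∀ p : ℕ, p.Prime → sigmaPrime Q p = 1 := by
  constructor
  · intro h
    obtain ⟨f, hf, hf0⟩ := Submodule.exists_mem_ne_zero_of_ne_bot h
    rw [mem_invariants_iff hρ] at hf
    have hne : ∃ x, f x ≠ 0 := Finsupp.ne_iff.mp hf0
    have hlocal : ∀ p : ℕ, p.Prime → sigmaPrime Q p = 1 ∧
        IsSquare (Nat.card (AddCommGroup.primaryComponent M p)) := by
      intro p hp
      obtain ⟨V, hV, hV'⟩ := exists_selfDual_primary hQ hp (hr p hp) hne hf.1 hf.2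
      exact ⟨gaussSigma_eq_one (hQ.primaryForm hp) hV hV',
        ⟨_, (card_eq_sq_of_orth_eq (hQ.primaryForm hp) hV').trans (sq _)⟩⟩
    obtain ⟨U, -, hU⟩ := exists_selfDual hQ hr (fun p hp => (hlocal p hp).2)
      fun p hp => (hlocal p hp).1
    exact ⟨⟨_, (card_eq_sq_of_orth_eq hQ hU).trans (sq _)⟩, fun p hp => (hlocal p hp).1⟩
  · rintro ⟨hsq, hσ⟩
    obtain ⟨U, hU, hU'⟩ := exists_selfDual hQ hr
      (fun p hp => isSquare_card_primaryComponent hp hsq) hσ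
    exact invariants_ne_bot_of_selfDual hQ hρ hU hU'

end Global

/-! ### The determinant group of a half-integral matrix -/

open scoped Pointwise in
theorem card_torsion_le_of_finrank {M : Type*} [AddCommGroup M] [Finite M] {p : ℕ} (hp : p.Prime)
    {r : ℕ} (h : Module.finrank (ZMod p) (ZMod p ⊗[ℤ] M) ≤ r) :
    Nat.card {x : M // p • x = 0} ≤ p ^ r := by
  have := Fact.mk hp
  have hfin : Module.Finite ℤ M := Module.Finite.of_finite
  have h1 : Nat.card (ZMod p ⊗[ℤ] M) ≤ p ^ r := by
    rw [Module.natCard_eq_pow_finrank (K := ZMod p), Nat.card_zmod]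
    exact Nat.pow_le_pow_right hp.pos h
  have e1 : ((ℤ ⧸ Ideal.span {(p : ℤ)}) ⊗[ℤ] M) ≃ₗ[ℤ] (ZMod p ⊗[ℤ] M) :=
    TensorProduct.congr (Int.quotientSpanNatEquivZMod p).toAddEquiv.toIntLinearEquiv
      (LinearEquiv.refl ℤ M)
  have h2 : Nat.card (ZMod p ⊗[ℤ] M) =
      Nat.card (M ⧸ (Ideal.span {(p : ℤ)} • (⊤ : Submodule ℤ M))) :=
    Nat.card_congr
      (e1.symm.trans (TensorProduct.quotTensorEquivQuotSMul M (Ideal.span {(p : ℤ)}))).toEquiv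
  have h3 : (Ideal.span {(p : ℤ)} • (⊤ : Submodule ℤ M)).toAddSubgroup =
      (nsmulAddMonoidHom (α := M) p).range := by
    rw [Submodule.ideal_span_singleton_smul]
    ext x
    constructor
    · rintro ⟨y, -, rfl⟩
      exact ⟨y, (natCast_zsmul y p).symm⟩
    · rintro ⟨y, rfl⟩
      exact ⟨y, trivial, natCast_zsmul y p⟩
  rw [← index_range_nsmul, ← h3]
  exact (h2.symm.trans_le h1 :)

namespace HalfIntegralMatrix

open Matrix

variable {n : ℕ} (F : HalfIntegralMatrix n)

theorem polar_discForm_mk (x y : Fin n → ℤ) :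
    QuadraticMap.polar F.discForm (x : F.discGroup) (y : F.discGroup) =
      ((F.halfBilin x y : ℚ) : AddCircle (1 : ℚ)) := F.polar_discFun_mk x y

theorem discForm_nondegenerate : IsNondegenerate F.discForm := by
  intro x hx
  induction x using QuotientAddGroup.induction_on with
  | H x =>
    rw [QuotientAddGroup.eq_zero_iff]
    -- pairing with the standard basis shows that `½ F⁻¹ x` is integral
    have h1 : ∀ i, ∃ a : ℤ, ((F.mat⁻¹ *ᵥ toRat x) i) = 2 * a := by
      intro i
      have h2 := hx ((Pi.single i 1 : Fin n → ℤ) : F.discGroup)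
      rw [polar_symm, polar_discForm_mk, AddCircle.coe_eq_zero_iff] at h2
      obtain ⟨a, ha⟩ := h2
      refine ⟨a, ?_⟩
      have h : toRat (Pi.single i 1 : Fin n → ℤ) = Pi.single i (1 : ℚ) := by
        funext j
        by_cases hj : j = i
        · subst hj; simp
        · simp [hj]
      rw [halfBilin, h, single_dotProduct] at ha
      simp at ha
      linarith
    choose a ha using h1
    refine ⟨a, ?_⟩
    have hdet : IsUnit F.mat.det := isUnit_iff_ne_zero.mpr F.nondegenerate
    have h3 : F.mat⁻¹ *ᵥ toRat x = (2 : ℚ) • toRat a := by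
      funext i
      rw [ha]; simp
    rw [smul_mulVec, ← mulVec_smul, ← h3, mulVec_mulVec, mul_nonsing_inv _ hdet, one_mulVec]

theorem card_discGroup : (Nat.card F.discGroup : ℚ) = |((2 : ℚ) • F.mat).det| := by
  choose G hG using F.integral
  have hG' : (Matrix.of G).map (Int.castRingHom ℚ) = (2 : ℚ) • F.mat := by
    ext i j
    simp [hG]
  set A : Matrix (Fin n) (Fin n) ℤ := Matrix.of G with hA
  have hdetQ : ((2 : ℚ) • F.mat).det = (A.det : ℚ) := by
    rw [← hG', ← RingHom.mapMatrix_apply, ← RingHom.map_det]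
    simp
  have hdet : A.det ≠ 0 := by
    intro h0
    rw [h0, det_smul, Int.cast_zero] at hdetQ
    exact (mul_ne_zero (pow_ne_zero _ two_ne_zero) F.nondegenerate) hdetQ
  have hinj : Function.Injective (Matrix.toLin' A) := by
    rw [Matrix.toLin'_apply']
    exact Matrix.mulVec_injective_of_det_ne_zero hdet
  set N := LinearMap.range (Matrix.toLin' A) with hN
  have hlat : F.lattice = N.toAddSubgroup := by
    ext x
    have h1 : ∀ y : Fin n → ℤ, toRat (A *ᵥ y) = ((2 : ℚ) • F.mat) *ᵥ toRat y := by
      intro y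
      rw [← hG']
      funext i
      simp [mulVec, dotProduct]
    have h2 : Function.Injective (toRat (n := n)) := by
      intro u v huv
      funext i
      have := congrFun huv i
      simpa using this
    constructor
    · rintro ⟨y, hy⟩
      exact ⟨y, h2 (by rw [hy, ← h1]; rfl)⟩
    · rintro ⟨y, rfl⟩
      exact ⟨y, h1 y⟩
  have h3 : Nat.card F.discGroup = A.det.natAbs := by
    change F.lattice.index = _
    rw [hlat]
    change Nat.card ((Fin n → ℤ) ⧸ N) = _
    rw [← Submodule.natAbs_det_equiv N (LinearEquiv.ofInjective (Matrix.toLin' A) hinj),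
      ← LinearMap.det_toLin' A]
    rfl
  rw [h3, hdetQ, Nat.cast_natAbs, Int.cast_abs]

theorem isSquare_card_discGroup_iff :
    IsSquare (Nat.card F.discGroup) ↔ ∃ m : ℤ, |((2 : ℚ) • F.mat).det| = (m : ℚ) ^ 2 := by
  rw [← card_discGroup]
  constructor
  · rintro ⟨m, hm⟩
    exact ⟨m, by rw [hm]; push_cast; ring⟩
  · rintro ⟨m, hm⟩
    refine ⟨m.natAbs, ?_⟩
    zify
    rw [← sq, sq_abs]
    exact_mod_cast hm

end HalfIntegralMatrix

end

theorem mainTheorem5 {n : ℕ} (F : HalfIntegralMatrix n)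
    (hrank : ∀ p : ℕ, p.Prime → Module.finrank (ZMod p) (ZMod p ⊗[ℤ] F.discGroup) ≤ 2) :
    (∃ ρ : Representation ℂ Metaplectic (F.discGroup →₀ ℂ),
      IsWeilRepresentation F.discForm ρ) ∧
    ∀ ρ : Representation ℂ Metaplectic (F.discGroup →₀ ℂ), IsWeilRepresentation F.discForm ρ →
      (ρ.invariants ≠ ⊥ ↔
        (∃ m : ℤ, |((2 : ℚ) • F.mat).det| = (m : ℚ) ^ 2) ∧
          ∀ p : ℕ, p.Prime → sigmaPrime F.discForm p = 1) := by
  refine ⟨exists_isWeilRepresentation F.discForm_nondegenerate, fun ρ hρ => ?_⟩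
  rw [← F.isSquare_card_discGroup_iff]
  exact invariants_ne_bot_iff F.discForm_nondegenerate
    (fun p hp => card_torsion_le_of_finrank hp (hrank p hp)) hρ
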